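/- Let $k$ be an algebraically closed field of characteristic different from $2$. A curve means a non-singular projective variety of dimension one over $k$. Let $\alpha_2,\alpha_3,\beta_2,\beta_3\in k$ be non-zero and pairwise distinct, assume that $\alpha_2\alpha_3=\beta_2\beta_3$, and let $E_1$ and $E_2$ be the elliptic curves $$E_1\colon y_1^2=x(x-\alpha_2)(x-\alpha_3),\qquad E_2\colon y_2^2=x(x-\beta_2)(x-\beta_3),$$ both regarded as double covers of $\mathbb{P}^1$ through the coordinate $x$. Choose square roots $\sqrt{\alpha_2},\sqrt{\alpha_3},\sqrt{\beta_2},\sqrt{\beta_3}\in k$ with $\sqrt{\alpha_2}\sqrt{\alpha_3}=\sqrt{\beta_2}\sqrt{\beta_3}$ (such a choice exists). Then $\alpha_2+\alpha_3-\beta_2-\beta_3\neq 0$, and for every such choice the polynomial $$\begin{aligned}f(x)=&\left(x^2-\frac{(\sqrt{\alpha_2}+\sqrt{\alpha_3}+\sqrt{\beta_2}+\sqrt{\beta_3})^2}{\alpha_2+\alpha_3-\beta_2-\beta_3}\right)\left(x^2-\frac{(\sqrt{\alpha_2}+\sqrt{\alpha_3}-\sqrt{\beta_2}-\sqrt{\beta_3})^2}{\alpha_2+\alpha_3-\beta_2-\beta_3}\right)\\&\left(x^2-\frac{(\sqrt{\alpha_2}-\sqrt{\alpha_3}+\sqrt{\beta_2}-\sqrt{\beta_3})^2}{\alpha_2+\alpha_3-\beta_2-\beta_3}\right)\left(x^2-\frac{(\sqrt{\alpha_2}-\sqrt{\alpha_3}-\sqrt{\beta_2}+\sqrt{\beta_3})^2}{\alpha_2+\alpha_3-\beta_2-\beta_3}\right)\end{aligned}$$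 is square-free of degree $8$, so that $y^2=f(x)$ represents a hyperelliptic curve of genus $3$, obtained by gluing the affine curves $y^2=f(x)$ and $v^2=u^8f(1/u)$ along $u=1/x$, $v=y/x^4$. This glued scheme is a curve, it is birational over $k$ to $E_1\times_{\mathbb{P}^1}E_2$, and every curve $C$ over $k$ that is birational over $k$ to $E_1\times_{\mathbb{P}^1}E_2$ is isomorphic over $k$ to it. -/

import Mathlib

open CategoryTheory CategoryTheory.Limits AlgebraicGeometry Polynomial

universe u

noncomputable section

namespace HoweCurve

variable (k : Type u) [Field k]

/-! ### The projective line as two affine lines glued along `x ↦ 1 / x` -/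

/-- The inclusion of `Spec k[T, T⁻¹]` in the affine line with coordinate `x = T`. -/
def torusInl : Spec (.of (LaurentPolynomial k)) ⟶ Spec (.of k[X]) :=
  Spec.map (CommRingCat.ofHom (algebraMap k[X] (LaurentPolynomial k)))

/-- The inclusion of `Spec k[T, T⁻¹]` in the affine line with coordinate `u = T⁻¹`. -/
def torusInr : Spec (.of (LaurentPolynomial k)) ⟶ Spec (.of k[X]) :=
  Spec.map (CommRingCat.ofHom (LaurentPolynomial.invert (R := k)).toRingEquiv.toRingHom) ≫
    torusInl k

instance : IsOpenImmersion (torusInl k) :=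
  IsOpenImmersion.of_isLocalization (X : k[X])

instance : IsOpenImmersion (torusInr k) := by
  have : IsIso (CommRingCat.ofHom (LaurentPolynomial.invert (R := k)).toRingEquiv.toRingHom) :=
    (LaurentPolynomial.invert (R := k)).toRingEquiv.toCommRingCatIso.isIso_hom
  unfold torusInr
  infer_instance

/-- The projective line over `k`. -/
def P1 : Scheme.{u} := pushout (torusInl k) (torusInr k)

/-- The affine line with coordinate `x` in the projective line. -/
def P1.inl : Spec (.of k[X]) ⟶ P1 k := pushout.inl (torusInl k) (torusInr k)

/-- The affine line with coordinate `u = 1 / x` in the projective line. -/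
def P1.inr : Spec (.of k[X]) ⟶ P1 k := pushout.inr (torusInl k) (torusInr k)

lemma P1.condition : torusInl k ≫ P1.inl k = torusInr k ≫ P1.inr k := pushout.condition

/-- The structure morphism of the projective line. -/
def P1.toSpec : P1 k ⟶ Spec (.of k) :=
  pushout.desc (Spec.map (CommRingCat.ofHom C)) (Spec.map (CommRingCat.ofHom C)) (by
    simp only [torusInr, torusInl, ← Spec.map_comp]
    congr 1
    ext a
    simp)

variable {k}

/-! ### The curve `y ^ 2 = f(x)` -/

/-- The coordinate ring `k[x, y] / (y ^ 2 - f(x))`. -/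
abbrev Chart (f : k[X]) : Type u := AdjoinRoot (X ^ 2 - C f : k[X][X])

/-- The function `x` on the affine curve `y ^ 2 = f(x)`. -/
def Chart.x (f : k[X]) : Chart f := algebraMap k[X] (Chart f) X

/-- The function `y` on the affine curve `y ^ 2 = f(x)`. -/
def Chart.y (f : k[X]) : Chart f := AdjoinRoot.root _

/-- The coordinate ring of the locus `x ≠ 0` in the affine curve `y ^ 2 = f(x)`. -/
abbrev Overlap (f : k[X]) : Type u := Localization.Away (Chart.x f)

namespace Overlap

variable (f : k[X])

def x : Overlap f := algebraMap (Chart f) (Overlap f) (Chart.x f)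

def y : Overlap f := algebraMap (Chart f) (Overlap f) (Chart.y f)

/-- The inverse `1 / x` of `x`. -/
def xInv : Overlap f := IsLocalization.Away.invSelf (Chart.x f)

lemma x_mul_xInv : x f * xInv f = 1 := IsLocalization.Away.mul_invSelf _

/-- The ring homomorphism `p(x) ↦ p(1 / x)`. -/
def evalInv : k[X] →+* Overlap f := eval₂RingHom (algebraMap k (Overlap f)) (xInv f)

lemma algebraMap_eq_eval₂ (p : k[X]) :
    algebraMap (Chart f) (Overlap f) (algebraMap k[X] (Chart f) p) =
      p.eval₂ (algebraMap k (Overlap f)) (x f) := by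
  have : (algebraMap (Chart f) (Overlap f)).comp (algebraMap k[X] (Chart f)) =
      eval₂RingHom (algebraMap k (Overlap f)) (x f) := by
    ext a
    · simp only [RingHom.comp_apply, coe_eval₂RingHom, eval₂_C,
        IsScalarTower.algebraMap_apply k (Chart f) (Overlap f),
        IsScalarTower.algebraMap_apply k k[X] (Chart f), algebraMap_eq]
    · simp [x, Chart.x]
  exact congr($this p)

lemma y_sq : y f ^ 2 = f.eval₂ (algebraMap k (Overlap f)) (x f) := by
  rw [← algebraMap_eq_eval₂, y, ← map_pow]
  congr 1
  have h := AdjoinRoot.eval₂_root (X ^ 2 - C f : k[X][X])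
  rw [eval₂_sub, eval₂_X_pow, eval₂_C, sub_eq_zero] at h
  exact h

variable {f} {g : k[X]} {n : ℕ}

lemma flip_rel (hf : f.natDegree ≤ 2 * n) (hg : reflect (2 * n) f = g) :
    (X ^ 2 - C g).eval₂ (evalInv f) (y f * xInv f ^ n) = 0 := by
  subst hg
  let : Invertible (x f) := ⟨xInv f, by rw [mul_comm, x_mul_xInv], x_mul_xInv f⟩
  have h := eval₂_reflect_mul_pow (algebraMap k (Overlap f)) (x f) (2 * n) f hf
  change (reflect (2 * n) f).eval₂ _ (xInv f) * x f ^ (2 * n) = _ at h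
  have hx : x f ^ (2 * n) * xInv f ^ (2 * n) = 1 := by rw [← mul_pow, x_mul_xInv, one_pow]
  rw [eval₂_sub, eval₂_X_pow, eval₂_C, sub_eq_zero, mul_pow, y_sq, ← h, ← pow_mul, mul_comm n 2,
    mul_assoc, hx, mul_one]
  rfl

/-- The change of charts `u = 1 / x`, `v = y / x ^ n`, from the coordinate ring of the curve
`v ^ 2 = g(u)`, where `g(u) = u ^ (2 * n) * f(1 / u)`, to that of the locus `x ≠ 0` in the curve
`y ^ 2 = f(x)`. -/
def flip (hf : f.natDegree ≤ 2 * n) (hg : reflect (2 * n) f = g) : Chart g →+* Overlap f :=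
  AdjoinRoot.lift (evalInv f) (y f * xInv f ^ n) (flip_rel hf hg)

lemma flip_algebraMap (hf : f.natDegree ≤ 2 * n) (hg : reflect (2 * n) f = g) (p : k[X]) :
    flip hf hg (algebraMap k[X] (Chart g) p) = evalInv f p :=
  AdjoinRoot.lift_of _

lemma flip_x (hf : f.natDegree ≤ 2 * n) (hg : reflect (2 * n) f = g) :
    flip hf hg (Chart.x g) = xInv f := by
  have h := flip_algebraMap hf hg X
  rwa [evalInv, coe_eval₂RingHom, eval₂_X] at h

lemma flip_y (hf : f.natDegree ≤ 2 * n) (hg : reflect (2 * n) f = g) :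
    flip hf hg (Chart.y g) = y f * xInv f ^ n :=
  AdjoinRoot.lift_root _

/-- The extension of `flip` to the locus `u ≠ 0`. -/
def flipLoc (hf : f.natDegree ≤ 2 * n) (hg : reflect (2 * n) f = g) : Overlap g →+* Overlap f :=
  IsLocalization.Away.lift (Chart.x g) (g := flip hf hg) (by
    rw [flip_x]
    exact IsUnit.of_mul_eq_one (x f) (by rw [mul_comm, x_mul_xInv]))

lemma flipLoc_algebraMap (hf : f.natDegree ≤ 2 * n) (hg : reflect (2 * n) f = g) (a : Chart g) :
    flipLoc hf hg (algebraMap _ _ a) = flip hf hg a :=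
  IsLocalization.Away.lift_eq _ _ _

lemma flipLoc_x (hf : f.natDegree ≤ 2 * n) (hg : reflect (2 * n) f = g) :
    flipLoc hf hg (x g) = xInv f := by
  rw [x, flipLoc_algebraMap, flip_x]

lemma flipLoc_y (hf : f.natDegree ≤ 2 * n) (hg : reflect (2 * n) f = g) :
    flipLoc hf hg (y g) = y f * xInv f ^ n := by
  rw [y, flipLoc_algebraMap, flip_y]

lemma flipLoc_xInv (hf : f.natDegree ≤ 2 * n) (hg : reflect (2 * n) f = g) :
    flipLoc hf hg (xInv g) = x f := by
  have h : flipLoc hf hg (x g * xInv g) = 1 := by rw [x_mul_xInv, map_one]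
  rw [map_mul, flipLoc_x] at h
  calc flipLoc hf hg (xInv g) = x f * xInv f * flipLoc hf hg (xInv g) := by
        rw [x_mul_xInv, one_mul]
    _ = x f := by rw [mul_assoc, h, mul_one]

lemma flipLoc_const (hf : f.natDegree ≤ 2 * n) (hg : reflect (2 * n) f = g) (a : k) :
    flipLoc hf hg (algebraMap k (Overlap g) a) = algebraMap k (Overlap f) a := by
  rw [IsScalarTower.algebraMap_apply k (Chart g) (Overlap g), flipLoc_algebraMap,
    IsScalarTower.algebraMap_apply k k[X] (Chart g), flip_algebraMap, algebraMap_eq]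
  simp [evalInv]

lemma flipLoc_flipLoc (hf : f.natDegree ≤ 2 * n) (hg : reflect (2 * n) f = g)
    (hg' : g.natDegree ≤ 2 * n) (hf' : reflect (2 * n) g = f) :
    (flipLoc hf hg).comp (flipLoc hg' hf') = RingHom.id _ := by
  refine IsLocalization.ringHom_ext (Submonoid.powers (Chart.x f)) ?_
  refine AdjoinRoot.ringHom_ext ?_ ?_
  · refine Polynomial.ringHom_ext (fun a ↦ ?_) ?_
    · have : algebraMap (Chart f) (Overlap f) (AdjoinRoot.of _ (C a)) =
          algebraMap k (Overlap f) a := rfl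
      simp only [RingHom.comp_apply, this, flipLoc_const, RingHom.id_apply]
    · change flipLoc hf hg (flipLoc hg' hf' (x f)) = x f
      rw [flipLoc_x, flipLoc_xInv]
  · change flipLoc hf hg (flipLoc hg' hf' (y f)) = y f
    rw [flipLoc_y, map_mul, map_pow, flipLoc_y, flipLoc_xInv, mul_assoc, ← mul_pow,
      mul_comm (xInv f), x_mul_xInv, one_pow, mul_one]

lemma natDegree_reflect (hf : f.natDegree ≤ 2 * n) : (reflect (2 * n) f).natDegree ≤ 2 * n :=
  natDegree_reflect_le.trans (by simp [hf])

lemma isOpenImmersion_flip (hf : f.natDegree ≤ 2 * n) (hg : reflect (2 * n) f = g) :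
    IsOpenImmersion (Spec.map (CommRingCat.ofHom (flip hf hg))) := by
  have hg' : g.natDegree ≤ 2 * n := hg ▸ natDegree_reflect hf
  have hf' : reflect (2 * n) g = f := by rw [← hg, reflect_reflect]
  let e : Overlap g ≃+* Overlap f := RingEquiv.ofRingHom (flipLoc hf hg) (flipLoc hg' hf')
    (flipLoc_flipLoc hf hg hg' hf') (flipLoc_flipLoc hg' hf' hf hg)
  have he : flip hf hg = e.toRingHom.comp (algebraMap (Chart g) (Overlap g)) :=
    RingHom.ext fun a ↦ (flipLoc_algebraMap hf hg a).symm
  have : IsIso (CommRingCat.ofHom e.toRingHom) := e.toCommRingCatIso.isIso_hom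
  have : IsOpenImmersion (Spec.map (CommRingCat.ofHom (algebraMap (Chart g) (Overlap g)))) :=
    IsOpenImmersion.of_isLocalization (Chart.x g)
  rw [he, CommRingCat.ofHom_comp, Spec.map_comp]
  infer_instance

end Overlap

/-- An equation `y ^ 2 = f(x)` of a hyperelliptic curve of genus `g` (an elliptic curve if
`g = 1`): the polynomial `f` is square-free of degree `2 * g + 1` or `2 * g + 2`. -/
structure HyperellipticEquation (k : Type u) [Field k] (g : ℕ) where
  /-- The right-hand side of the equation. -/
  poly : k[X]
  squarefree : Squarefree poly
  natDegree_eq : poly.natDegree = 2 * g + 1 ∨ poly.natDegree = 2 * g + 2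

namespace HyperellipticEquation

variable {g : ℕ} (D : HyperellipticEquation k g)

lemma natDegree_le : D.poly.natDegree ≤ 2 * (g + 1) := by
  have := D.natDegree_eq
  omega

/-- The right-hand side of the equation `v ^ 2 = u ^ (2 * g + 2) * f(1 / u)` of the chart at
infinity. -/
def polyInfty : k[X] := reflect (2 * (g + 1)) D.poly

lemma reflect_poly : reflect (2 * (g + 1)) D.poly = D.polyInfty := rfl

/-- The inclusion of the locus `x ≠ 0` in the affine curve `y ^ 2 = f(x)`. -/
def overlapInl : Spec (.of (Overlap D.poly)) ⟶ Spec (.of (Chart D.poly)) :=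
  Spec.map (CommRingCat.ofHom (algebraMap _ _))

/-- The open immersion `(x, y) ↦ (1 / x, y / x ^ (g + 1))` of the locus `x ≠ 0` of the curve
`y ^ 2 = f(x)` in the affine curve `v ^ 2 = u ^ (2 * g + 2) * f(1 / u)`. -/
def overlapInr : Spec (.of (Overlap D.poly)) ⟶ Spec (.of (Chart D.polyInfty)) :=
  Spec.map (CommRingCat.ofHom (Overlap.flip D.natDegree_le D.reflect_poly))

instance : IsOpenImmersion D.overlapInl := IsOpenImmersion.of_isLocalization (Chart.x D.poly)

instance : IsOpenImmersion D.overlapInr := Overlap.isOpenImmersion_flip D.natDegree_le D.reflect_poly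

/-- The curve represented by the equation `y ^ 2 = f(x)`: the affine curves `y ^ 2 = f(x)` and
`v ^ 2 = u ^ (2 * g + 2) * f(1 / u)` glued along `(x, y) ↦ (1 / x, y / x ^ (g + 1))`. -/
def curve : Scheme.{u} := pushout D.overlapInl D.overlapInr

/-- The projection `(x, y) ↦ x` of the affine curve `y ^ 2 = f(x)`. -/
def projInl : Spec (.of (Chart D.poly)) ⟶ Spec (.of k[X]) :=
  Spec.map (CommRingCat.ofHom (algebraMap k[X] (Chart D.poly)))

/-- The projection `(u, v) ↦ u` of the affine curve at infinity. -/
def projInr : Spec (.of (Chart D.polyInfty)) ⟶ Spec (.of k[X]) :=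
  Spec.map (CommRingCat.ofHom (algebraMap k[X] (Chart D.polyInfty)))

lemma proj_condition :
    D.overlapInl ≫ D.projInl ≫ P1.inl k = D.overlapInr ≫ D.projInr ≫ P1.inr k := by
  have hu : IsUnit ((algebraMap (Chart D.poly) (Overlap D.poly)).comp
      (algebraMap k[X] (Chart D.poly)) X) :=
    IsUnit.of_mul_eq_one _ (Overlap.x_mul_xInv D.poly)
  let φ : LaurentPolynomial k →+* Overlap D.poly := IsLocalization.Away.lift (X : k[X]) hu
  have hφ (p : k[X]) : φ (algebraMap k[X] (LaurentPolynomial k) p) =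
      algebraMap (Chart D.poly) (Overlap D.poly) (algebraMap k[X] (Chart D.poly) p) :=
    IsLocalization.Away.lift_eq _ hu p
  have hT : φ (LaurentPolynomial.T 1) = Overlap.x D.poly := by
    have := hφ X
    rwa [LaurentPolynomial.algebraMap_eq_toLaurent, toLaurent_X] at this
  have hT' : φ (LaurentPolynomial.T (-1)) = Overlap.xInv D.poly := by
    have h : φ (LaurentPolynomial.T (-1) * LaurentPolynomial.T 1) = 1 := by
      rw [← LaurentPolynomial.T_add]; simp
    rw [map_mul, hT] at h
    calc φ (LaurentPolynomial.T (-1)) =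
          φ (LaurentPolynomial.T (-1)) * (Overlap.x D.poly * Overlap.xInv D.poly) := by
          rw [Overlap.x_mul_xInv, mul_one]
      _ = Overlap.xInv D.poly := by rw [← mul_assoc, h, one_mul]
  have h₁ : D.overlapInl ≫ D.projInl = Spec.map (CommRingCat.ofHom φ) ≫ torusInl k := by
    simp only [overlapInl, projInl, torusInl, ← Spec.map_comp, ← CommRingCat.ofHom_comp]
    congr 2
    exact RingHom.ext fun p ↦ (hφ p).symm
  have h₂ : D.overlapInr ≫ D.projInr = Spec.map (CommRingCat.ofHom φ) ≫ torusInr k := by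
    simp only [overlapInr, projInr, torusInr, torusInl, ← Spec.map_comp, ← CommRingCat.ofHom_comp]
    congr 2
    refine Polynomial.ringHom_ext (fun a ↦ ?_) ?_
    · have h := hφ (C a)
      rw [Overlap.algebraMap_eq_eval₂, eval₂_C, LaurentPolynomial.algebraMap_eq_toLaurent,
        toLaurent_C] at h
      rw [RingHom.comp_apply, Overlap.flip_algebraMap, Overlap.evalInv, coe_eval₂RingHom, eval₂_C,
        ← h]
      simp
    · rw [RingHom.comp_apply, Overlap.flip_algebraMap, Overlap.evalInv, coe_eval₂RingHom, eval₂_X,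
        ← hT']
      simp
  rw [reassoc_of% h₁, reassoc_of% h₂, P1.condition]

/-- The double cover of the projective line given by the coordinate `x` (and `u = 1 / x`). -/
def toP1 : D.curve ⟶ P1 k :=
  pushout.desc (D.projInl ≫ P1.inl k) (D.projInr ≫ P1.inr k) D.proj_condition

/-- The structure morphism of the curve. -/
def toSpec : D.curve ⟶ Spec (.of k) := D.toP1 ≫ P1.toSpec k

end HyperellipticEquation

/-- The elliptic curve `y ^ 2 = x * (x - a) * (x - b)` with `0`, `a`, `b` pairwise distinct. -/
def ellipticEquation (a b : k) (ha : a ≠ 0) (hb : b ≠ 0) (hab : a ≠ b) :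
    HyperellipticEquation k 1 where
  poly := X * (X - C a) * (X - C b)
  squarefree := by
    have h : (X * (X - C a) * (X - C b)).Separable := by
      refine Separable.mul (Separable.mul separable_X (separable_X_sub_C (x := a)) ?_)
        (separable_X_sub_C (x := b)) (IsCoprime.mul_left ?_ ?_)
      · simpa using isCoprime_X_sub_C_of_isUnit_sub (R := k) (a := 0) (b := a) (by simpa using ha)
      · simpa using isCoprime_X_sub_C_of_isUnit_sub (R := k) (a := 0) (b := b) (by simpa using hb)
      · exact isCoprime_X_sub_C_of_isUnit_sub (by simpa [sub_eq_zero] using hab)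
    exact h.squarefree
  natDegree_eq := by
    left
    rw [natDegree_mul (mul_ne_zero X_ne_zero (X_sub_C_ne_zero a)) (X_sub_C_ne_zero b),
      natDegree_mul X_ne_zero (X_sub_C_ne_zero a), natDegree_X, natDegree_X_sub_C,
      natDegree_X_sub_C]

/-- The fibre product over the projective line of two curves given by equations. -/
def fiberProduct {g₁ g₂ : ℕ} (D₁ : HyperellipticEquation k g₁) (D₂ : HyperellipticEquation k g₂) :
    Scheme.{u} :=
  pullback D₁.toP1 D₂.toP1

/-- The structure morphism of the fibre product over the projective line. -/
def fiberProductToSpec {g₁ g₂ : ℕ} (D₁ : HyperellipticEquation k g₁)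
    (D₂ : HyperellipticEquation k g₂) : fiberProduct D₁ D₂ ⟶ Spec (.of k) :=
  pullback.fst D₁.toP1 D₂.toP1 ≫ D₁.toSpec

/-- A scheme `s : S ⟶ Spec k` over an algebraically closed field `k` is a curve, in the sense of a
non-singular projective variety of dimension one: it is integral and proper over `k`, and its local
ring at each closed point is regular of dimension one. (A proper curve over a field is
projective.) -/
structure IsCurve {S : Scheme.{u}} (s : S ⟶ Spec (.of k)) : Prop where
  isIntegral : IsIntegral S
  isProper : IsProper s
  regular : ∀ p : S, IsClosed ({p} : Set S) → IsRegularLocalRing (S.presheaf.stalk p)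
  ringKrullDim_eq_one : ∀ p : S, IsClosed ({p} : Set S) → ringKrullDim (S.presheaf.stalk p) = 1

end HoweCurve

end

/-! ### Divisibility and integrality over a principal ideal domain -/

/-! Write A = α₂ + α₃, p = α₂α₃ = β₂β₃ and c = α₂ + α₃ − β₂ − β₃. The cubics are x(x² − Ax + p) and
x(x² − (A − c)x + p), so a point of the fibre product with x ≠ 0 satisfies y₂² − y₁² = cx². This is
a conic in (y₁/x, y₂/x). With r² = −c it is parametrised by X = (y₂ − y₁)/(rx), with X⁻¹ = −(y₂ +
y₁)/(rx).

The first equation becomes x + p/x = A − c(X + X⁻¹)²/4. Hence x and p/x are the roots of a quadratic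
over k(X), and adjoining x means adjoining the square root of its discriminant. Scaled by X², this
root is Y with c²Y² = (c(X² + 1)² − 4AX²)² − 64pX⁴. As p = (a₂a₃)² and A ± 2a₂a₃ = (a₂ ± a₃)², the
right side is a difference of squares. Each of its two factors c(X² + 1)² − 4(a₂ ± a₃)²X² splits in
X², because c = (a₂ ± a₃)² − (b₂ ± b₃)²; this gives the four factors of f.

The substitutions invert each other over any ring where 2, c and p are units, so they identify the
locus X ≠ 0 of the octic with the locus x ≠ 0 of the fibre product
(`birationalOver_fiberProduct_of_octic`). That locus is dense because the double covers are open
maps.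

The glued scheme is a curve since both charts are Dedekind domains (`Chart.isDedekindDomain`), the
charts meet in a closed subscheme of their product (`lift_surjective`), and x or 1/x lies in any
given valuation ring (`existence_toSpec`). Uniqueness is the classical fact that birational
non-singular projective curves are isomorphic: the local rings at closed points are valuation rings,
so rational maps to a proper scheme extend everywhere (`IsCurve.exists_iso_of_birationalOver`). -/

theorem dvd_of_isIntegral_of_algebraMap_mul_eq {R K : Type*} [CommRing R] [IsDomain R]
    [IsIntegrallyClosed R] [Field K] [Algebra R K] [FaithfulSMul R K] {w : K} {m n : R}
    (hn : n ≠ 0) (hw : IsIntegral R w) (h : algebraMap R K n * w = algebraMap R K m) : n ∣ m := by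
  let : Algebra (FractionRing R) K := FractionRing.liftAlgebra R K
  have hn' : algebraMap R (FractionRing R) n ≠ 0 := by simpa using hn
  have hnK : algebraMap R K n ≠ 0 := by simpa using hn
  have hw' : w = algebraMap (FractionRing R) K
      (algebraMap R (FractionRing R) m / algebraMap R (FractionRing R) n) := by
    rw [map_div₀, ← IsScalarTower.algebraMap_apply, ← IsScalarTower.algebraMap_apply, ← h,
      mul_div_cancel_left₀ _ hnK]
  rw [hw', isIntegral_algebraMap_iff (algebraMap (FractionRing R) K).injective] at hw
  obtain ⟨y, hy⟩ := IsIntegrallyClosed.algebraMap_eq_of_integral hw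
  refine ⟨y, IsFractionRing.injective R (FractionRing R) ?_⟩
  rw [map_mul, hy, mul_div_cancel₀ _ hn']

/-- After division by the gcd, n' is coprime to q', so n'² divides f and n' is a unit. -/
theorem Squarefree.dvd_of_sq_dvd_sq_mul {R : Type*} [CommRing R] [IsDomain R]
    [IsPrincipalIdealRing R] {n q f : R} (hf : Squarefree f) (hn : n ≠ 0) (h : n ^ 2 ∣ q ^ 2 * f) :
    n ∣ q := by
  let : GCDMonoid R := UniqueFactorizationMonoid.toGCDMonoid R
  obtain ⟨n', q', hn', hq', hu⟩ := extract_gcd n q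
  have hg : gcd n q ≠ 0 := fun h0 ↦ hn (by rw [hn', h0, zero_mul])
  have hcop : IsCoprime n' q' := by
    rw [← gcd_isUnit_iff]
    exact hu
  have h1 : n' ^ 2 ∣ q' ^ 2 * f := by
    have hnq : n ^ 2 = gcd n q ^ 2 * n' ^ 2 := by rw [← mul_pow, ← hn']
    have hqq : q ^ 2 = gcd n q ^ 2 * q' ^ 2 := by rw [← mul_pow, ← hq']
    rw [hnq, hqq, mul_assoc] at h
    exact (mul_dvd_mul_iff_left (pow_ne_zero 2 hg)).mp h
  have h2 : n' * n' ∣ f := by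
    rw [← sq]
    exact hcop.pow.dvd_of_dvd_mul_left h1
  have h3 : IsUnit n' := hf n' h2
  calc n = gcd n q * n' := hn'
    _ ∣ gcd n q * q' := mul_dvd_mul_left _ h3.dvd
    _ = q := hq'.symm

namespace HoweCurve

/-! ### The affine curve y² = f(x) is a Dedekind domain -/

section Chart

variable {k : Type u} [Field k] {f : k[X]}

lemma chart_monic (f : k[X]) : (X ^ 2 - C f : k[X][X]).Monic := monic_X_pow_sub_C f two_ne_zero

lemma Chart.y_sq (f : k[X]) : Chart.y f ^ 2 = algebraMap k[X] (Chart f) f := by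
  have h := AdjoinRoot.eval₂_root (X ^ 2 - C f : k[X][X])
  rw [eval₂_sub, eval₂_X_pow, eval₂_C, sub_eq_zero] at h
  exact h

instance : Module.Finite k[X] (Chart f) := (chart_monic f).finite_adjoinRoot

instance : Module.Free k[X] (Chart f) := (chart_monic f).free_adjoinRoot

lemma Chart.exists_eq_add_mul_y (z : Chart f) :
    ∃ p q : k[X], z = algebraMap k[X] (Chart f) p + algebraMap k[X] (Chart f) q * Chart.y f := by
  obtain ⟨P, rfl⟩ := AdjoinRoot.mk_surjective z
  have hdeg : (P %ₘ (X ^ 2 - C f)).natDegree ≤ 1 := by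
    have := natDegree_modByMonic_lt P (chart_monic f) (fun h ↦ by
      have := congr_arg natDegree h
      rw [natDegree_X_pow_sub_C, natDegree_one] at this
      omega)
    rw [natDegree_X_pow_sub_C] at this
    omega
  obtain ⟨a, b, hab⟩ := exists_eq_X_add_C_of_natDegree_le_one hdeg
  refine ⟨b, a, ?_⟩
  have h : AdjoinRoot.mk (X ^ 2 - C f) P = AdjoinRoot.mk (X ^ 2 - C f) (P %ₘ (X ^ 2 - C f)) := by
    rw [AdjoinRoot.mk_eq_mk]
    exact ⟨P /ₘ (X ^ 2 - C f), by rw [sub_eq_iff_eq_add', modByMonic_add_div P]⟩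
  rw [h, hab, map_add, map_mul, add_comm]
  rfl

/-- A monic quadratic without roots is irreducible. A root r would give r² = f, so r would be a unit
and f constant. -/
lemma chart_irreducible (hf : Squarefree f) (hf0 : f.natDegree ≠ 0) :
    Irreducible (X ^ 2 - C f : k[X][X]) := by
  rw [(chart_monic f).irreducible_iff_roots_eq_zero_of_degree_le_three
    (by rw [natDegree_X_pow_sub_C]) (by rw [natDegree_X_pow_sub_C]; omega)]
  refine Multiset.eq_zero_of_forall_notMem fun r hr ↦ ?_
  have hr' := (mem_roots'.mp hr).2
  rw [IsRoot, eval_sub, eval_pow, eval_X, eval_C, sub_eq_zero] at hr'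
  have hu : IsUnit r := hf r ⟨1, by rw [mul_one, ← sq, hr']⟩
  apply hf0
  rw [← hr', natDegree_pow, natDegree_eq_zero_of_isUnit hu]

lemma Chart.isDomain (hf : Squarefree f) (hf0 : f.natDegree ≠ 0) : IsDomain (Chart f) :=
  AdjoinRoot.isDomain_of_prime (chart_irreducible hf hf0).prime

lemma Chart.algebraMap_injective (f : k[X]) : Function.Injective (algebraMap k[X] (Chart f)) :=
  AdjoinRoot.of.injective_of_degree_ne_zero (by
    rw [degree_eq_natDegree (chart_monic f).ne_zero, natDegree_X_pow_sub_C]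
    norm_num)

/-- The hyperelliptic involution `y ↦ -y` of the affine curve `y ^ 2 = f(x)`. -/
noncomputable def Chart.conjHom (f : k[X]) : Chart f →ₐ[k[X]] Chart f :=
  AdjoinRoot.liftAlgHom _ (Algebra.ofId _ _) (-Chart.y f) (by
    rw [eval₂_sub, eval₂_X_pow, eval₂_C, neg_sq, Chart.y_sq, sub_eq_zero]
    rfl)

lemma Chart.conjHom_y (f : k[X]) : Chart.conjHom f (Chart.y f) = -Chart.y f :=
  AdjoinRoot.liftAlgHom_root ..

lemma Chart.conjHom_conjHom (z : Chart f) : Chart.conjHom f (Chart.conjHom f z) = z := by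
  obtain ⟨p, q, rfl⟩ := Chart.exists_eq_add_mul_y z
  simp only [map_add, map_mul, AlgHom.commutes, Chart.conjHom_y, map_neg, neg_neg]

/-- The hyperelliptic involution as an automorphism. -/
noncomputable def Chart.conj (f : k[X]) : Chart f ≃ₐ[k[X]] Chart f :=
  AlgEquiv.ofAlgHom (Chart.conjHom f) (Chart.conjHom f)
    (AlgHom.ext Chart.conjHom_conjHom) (AlgHom.ext Chart.conjHom_conjHom)

/-- The norm of p + qy is p² − q²f. It allows every fraction to be written with a denominator in
k[x]. -/
lemma Chart.exists_mul_conj_eq (z : Chart f) :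
    ∃ n : k[X], z * Chart.conj f z = algebraMap k[X] (Chart f) n := by
  obtain ⟨p, q, rfl⟩ := Chart.exists_eq_add_mul_y z
  refine ⟨p ^ 2 - q ^ 2 * f, ?_⟩
  have : Chart.conj f (Chart.y f) = -Chart.y f := Chart.conjHom_y f
  rw [map_add, map_mul, AlgEquiv.commutes, AlgEquiv.commutes, this, map_sub, map_mul, map_pow,
    map_pow, ← Chart.y_sq]
  ring

/-- Write an integral element as z = (p + qy)/n with n in k[x]. Its trace 2p/n is integral over
k[x], so n divides p as 2 is invertible. Subtracting p/n leaves qy/n, whose square q²f/n² is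
integral; f being square-free, n divides q. -/
lemma Chart.isIntegrallyClosed (h2 : (2 : k) ≠ 0) (hf : Squarefree f) (hf0 : f.natDegree ≠ 0) :
    IsIntegrallyClosed (Chart f) := by
  have := Chart.isDomain hf hf0
  let K := FractionRing (Chart f)
  rw [isIntegrallyClosed_iff K]
  intro z hz
  have hinj : Function.Injective (algebraMap (Chart f) K) := IsFractionRing.injective _ _
  obtain ⟨a, b, hb, hab⟩ := IsFractionRing.div_surjective (Chart f) z
  have hb0 : b ≠ 0 := nonZeroDivisors.ne_zero hb
  obtain ⟨n, hn⟩ := Chart.exists_mul_conj_eq b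
  have hn0 : n ≠ 0 := by
    rintro rfl
    rw [map_zero, mul_eq_zero] at hn
    simp [hb0] at hn
  obtain ⟨p, q, hpq⟩ := Chart.exists_eq_add_mul_y (a * Chart.conj f b)
  -- The involution y ↦ −y on the function field; z + σ z is the trace.
  let σ : K ≃ₐ[k[X]] K := IsFractionRing.algEquivOfAlgEquiv (Chart.conj f)
  have hσ (a : Chart f) : σ (algebraMap _ K a) = algebraMap _ K (Chart.conj f a) :=
    IsFractionRing.algEquivOfAlgEquiv_algebraMap ..
  have hzn : algebraMap k[X] K n * z =
      algebraMap k[X] K p + algebraMap k[X] K q * algebraMap (Chart f) K (Chart.y f) := by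
    have hb' : algebraMap (Chart f) K b ≠ 0 := by simpa using hb0
    simp only [IsScalarTower.algebraMap_apply k[X] (Chart f) K]
    rw [← map_mul, ← map_add, ← hpq, ← hn, ← hab, map_mul, map_mul, mul_div_assoc', div_eq_iff hb']
    ring
  have hzn' : algebraMap k[X] K n * σ z =
      algebraMap k[X] K p - algebraMap k[X] K q * algebraMap (Chart f) K (Chart.y f) := by
    have h := congr_arg σ hzn
    rw [map_mul, map_add, map_mul, AlgEquiv.commutes, AlgEquiv.commutes, AlgEquiv.commutes, hσ] at h
    rw [h, show Chart.conj f (Chart.y f) = -Chart.y f from Chart.conjHom_y f, map_neg]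
    ring
  have hzi : IsIntegral k[X] z := isIntegral_trans (A := Chart f) z hz
  have hinjK : FaithfulSMul k[X] K := by
    rw [faithfulSMul_iff_algebraMap_injective, IsScalarTower.algebraMap_eq k[X] (Chart f) K]
    exact hinj.comp (Chart.algebraMap_injective f)
  have h2' : IsUnit (2 : k[X]) := by
    have : (2 : k[X]) = C 2 := (map_ofNat C 2).symm
    rw [this]
    exact (IsUnit.mk0 _ h2).map C
  obtain ⟨p', rfl⟩ : n ∣ p := by
    have h : n ∣ 2 * p := dvd_of_isIntegral_of_algebraMap_mul_eq (K := K) hn0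
      (hzi.add (hzi.map σ)) (by rw [mul_add, hzn, hzn', two_mul, map_add]; ring)
    exact (h2'.dvd_mul_left).mp h
  have hw : IsIntegral k[X] (z - algebraMap k[X] K p') := hzi.sub isIntegral_algebraMap
  obtain ⟨q', rfl⟩ : n ∣ q := by
    refine hf.dvd_of_sq_dvd_sq_mul hn0 ?_
    refine dvd_of_isIntegral_of_algebraMap_mul_eq (K := K) (pow_ne_zero 2 hn0) (hw.pow 2) ?_
    have h1 : algebraMap k[X] K n * (z - algebraMap k[X] K p') =
        algebraMap k[X] K q * algebraMap (Chart f) K (Chart.y f) := by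
      rw [mul_sub, hzn, map_mul]
      ring
    rw [map_pow, ← mul_pow, h1, mul_pow, ← map_pow, ← map_pow, Chart.y_sq,
      ← IsScalarTower.algebraMap_apply, ← map_mul]
  refine ⟨algebraMap k[X] (Chart f) p' + algebraMap k[X] (Chart f) q' * Chart.y f, ?_⟩
  have hn0' : algebraMap k[X] K n ≠ 0 := by simpa using hn0
  apply mul_left_cancel₀ hn0'
  rw [hzn, map_add, map_mul, map_mul, map_mul, ← IsScalarTower.algebraMap_apply,
    ← IsScalarTower.algebraMap_apply]
  ring

lemma Chart.isDedekindDomain (h2 : (2 : k) ≠ 0) (hf : Squarefree f) (hf0 : f.natDegree ≠ 0) :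
    IsDedekindDomain (Chart f) := by
  have := Chart.isDomain hf hf0
  have := Chart.isIntegrallyClosed h2 hf hf0
  have : IsNoetherianRing (Chart f) := IsNoetherianRing.of_finite k[X] (Chart f)
  have : Ring.DimensionLEOne (Chart f) := Ring.DimensionLEOne.of_isIntegral k[X] (Chart f)
  have : IsDedekindRing (Chart f) := {}
  exact {}

lemma Chart.not_isField (hf : Squarefree f) (hf0 : f.natDegree ≠ 0) : ¬ IsField (Chart f) := by
  have := Chart.isDomain hf hf0
  intro h
  exact Polynomial.not_isField k
    (isField_of_isIntegral_of_isField (Chart.algebraMap_injective f) h)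

end Chart

/-! ### The polynomial of the chart at infinity -/

section reflect

variable {k : Type u} [Field k]

/-- The bound N ≤ deg f + 1 means that X divides the reflection at most once. A repeated factor a is
therefore prime to X, and its reversal is a repeated factor of f of the same degree. -/
lemma squarefree_reflect {f : k[X]} {N : ℕ} (hf : Squarefree f) (hN : f.natDegree ≤ N)
    (hN' : N ≤ f.natDegree + 1) : Squarefree (reflect N f) := by
  rintro a ⟨b, hb⟩
  have hf0 : f ≠ 0 := hf.ne_zero
  have hr0 : reflect N f ≠ 0 := by simpa using hf0
  have ha : a ≠ 0 := by rintro rfl; simp [hr0] at hb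
  have hb0 : b ≠ 0 := by rintro rfl; simp [hr0] at hb
  have hdeg : a.natDegree + a.natDegree + b.natDegree ≤ N := by
    rw [← natDegree_mul ha ha, ← natDegree_mul (mul_ne_zero ha ha) hb0, ← hb]
    exact natDegree_reflect_le.trans (by simp [hN])
  have hX : ¬ X ∣ a := by
    rintro ⟨c, rfl⟩
    have hlead : f.coeff f.natDegree ≠ 0 := by simpa using hf0
    -- In degree N − deg f ≤ 1 the reflection has the leading coefficient of f, which X² dividing it
    -- would make zero.
    have h := congr_arg (fun p ↦ coeff p (N - f.natDegree)) hb
    simp only [coeff_reflect] at h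
    have hrev : revAt N (N - f.natDegree) = f.natDegree := by
      rw [revAt_le (by omega)]; omega
    rw [hrev, show X * c * (X * c) * b = c * c * b * X ^ 2 by ring, coeff_mul_X_pow'] at h
    rw [if_neg (by omega)] at h
    exact hlead h
  have hf' : f = a.reverse * a.reverse * reflect (N - (a.natDegree + a.natDegree)) b := by
    have h := congr_arg (reflect N) hb
    rw [reflect_reflect] at h
    rw [h]
    conv_lhs => rw [show N = (a.natDegree + a.natDegree) + (N - (a.natDegree + a.natDegree)) by omega]
    rw [reflect_mul _ _ (natDegree_mul_le) (by omega), reflect_mul _ _ le_rfl le_rfl]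
    rfl
  have hu := hf _ ⟨_, hf'⟩
  have h0 := natDegree_eq_zero_of_isUnit hu
  have ht : a.natTrailingDegree = 0 := by
    rw [natTrailingDegree_eq_zero]
    right
    rwa [X_dvd_iff] at hX
  rw [reverse_natDegree, ht, tsub_zero] at h0
  rw [isUnit_iff_degree_eq_zero, degree_eq_natDegree ha, h0]
  rfl

end reflect

namespace HyperellipticEquation

variable {k : Type u} [Field k] {g : ℕ} (D : HyperellipticEquation k g)

lemma natDegree_ne_zero : D.poly.natDegree ≠ 0 := by
  have := D.natDegree_eq
  omega

lemma squarefree_polyInfty : Squarefree D.polyInfty :=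
  squarefree_reflect D.squarefree D.natDegree_le (by have := D.natDegree_eq; omega)

/-- A constant reflection would make f a multiple of X ^ (2g + 2), which is not square-free. -/
lemma natDegree_polyInfty_ne_zero : D.polyInfty.natDegree ≠ 0 := by
  intro h
  have hf : D.poly = C (D.polyInfty.coeff 0) * X ^ (2 * (g + 1)) := by
    rw [← reflect_C, ← eq_C_of_natDegree_eq_zero h, polyInfty, reflect_reflect]
  have hu : IsUnit (X : k[X]) := by
    refine D.squarefree X ⟨C (D.polyInfty.coeff 0) * X ^ (2 * g), ?_⟩
    rw [hf]
    ring
  exact not_isUnit_X hu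

end HyperellipticEquation

end HoweCurve

/-! ### Gluing two schemes along an open subscheme -/

namespace AlgebraicGeometry

section pushout

variable {U X Y : Scheme.{u}} (f : U ⟶ X) (g : U ⟶ Y) [IsOpenImmersion f] [IsOpenImmersion g]

instance : IsOpenImmersion (pushout.inl f g) :=
  inferInstanceAs (IsOpenImmersion (colimit.ι (span f g) WalkingSpan.left))

instance : IsOpenImmersion (pushout.inr f g) :=
  inferInstanceAs (IsOpenImmersion (colimit.ι (span f g) WalkingSpan.right))

lemma pushout_jointly_surjective (p : ↥(pushout f g)) :
    (∃ x, pushout.inl f g x = p) ∨ ∃ y, pushout.inr f g y = p := by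
  obtain ⟨i, x, hx⟩ := Scheme.IsLocallyDirected.ι_jointly_surjective (span f g) p
  obtain (_ | _ | _) := i
  · refine .inl ⟨f x, ?_⟩
    rw [← hx, ← colimit.w (span f g) WalkingSpan.Hom.fst]
    rfl
  · exact .inl ⟨x, hx⟩
  · exact .inr ⟨x, hx⟩

lemma pushout_inl_eq_inr {x : X} {y : Y} (h : pushout.inl f g x = pushout.inr f g y) :
    ∃ u, f u = x ∧ g u = y := by
  obtain ⟨k, a, b, u, hu, hu'⟩ := (Scheme.IsLocallyDirected.ι_eq_ι_iff (span f g)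
    (i := WalkingSpan.left) (j := WalkingSpan.right)).mp h
  obtain (_ | _ | _) := k
  · refine ⟨u, ?_, ?_⟩
    · rwa [Subsingleton.elim a WalkingSpan.Hom.fst] at hu
    · rwa [Subsingleton.elim b WalkingSpan.Hom.snd] at hu'
  · exact nomatch b
  · exact nomatch a

/-- Points of the two charts are identified only when they come from U, so the overlap is the
intersection of the charts. -/
lemma isPullback_pushout_of_isOpenImmersion :
    IsPullback f g (pushout.inl f g) (pushout.inr f g) := by
  refine (IsOpenImmersion.isPullback g f (pushout.inr f g) (pushout.inl f g) pushout.condition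
    ?_).flip
  ext x
  constructor
  · rintro ⟨y, hy⟩
    obtain ⟨u, hu, -⟩ := pushout_inl_eq_inr f g hy.symm
    exact ⟨u, hu⟩
  · rintro ⟨u, rfl⟩
    refine ⟨g u, ?_⟩
    rw [← Scheme.Hom.comp_apply, ← pushout.condition, Scheme.Hom.comp_apply]

/-- The cover of a scheme glued from two open subschemes. -/
noncomputable def pushoutOpenCover : (pushout f g).OpenCover where
  I₀ := ULift.{u} Bool
  X b := if b.down then Y else X
  f b := match b with
    | ⟨false⟩ => pushout.inl f g
    | ⟨true⟩ => pushout.inr f g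
  mem₀ := by
    rw [Scheme.presieve₀_mem_precoverage_iff]
    refine ⟨fun x ↦ ?_, ?_⟩
    · obtain ⟨y, hy⟩ | ⟨y, hy⟩ := pushout_jointly_surjective f g x
      · exact ⟨⟨false⟩, y, hy⟩
      · exact ⟨⟨true⟩, y, hy⟩
    · rintro ⟨_ | _⟩
      · exact inferInstanceAs (IsOpenImmersion (pushout.inl f g))
      · exact inferInstanceAs (IsOpenImmersion (pushout.inr f g))

lemma pushout_source_local (P : MorphismProperty Scheme.{u}) [IsZariskiLocalAtSource P]
    {Z : Scheme.{u}} (s : pushout f g ⟶ Z) (hl : P (pushout.inl f g ≫ s))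
    (hr : P (pushout.inr f g ≫ s)) : P s := by
  rw [IsZariskiLocalAtSource.iff_of_openCover (P := P) (pushoutOpenCover f g)]
  rintro ⟨_ | _⟩
  · exact hl
  · exact hr

lemma isReduced_pushout [IsReduced X] [IsReduced Y] : IsReduced (pushout f g) := by
  have (i : (pushoutOpenCover f g).I₀) : IsReduced ((pushoutOpenCover f g).X i) := by
    obtain ⟨_ | _⟩ := i
    · exact ‹IsReduced X›
    · exact ‹IsReduced Y›
  exact IsReduced.of_openCover _ (pushoutOpenCover f g)

lemma irreducibleSpace_pushout [IrreducibleSpace X] [IrreducibleSpace Y] [Nonempty U] :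
    IrreducibleSpace ↥(pushout f g) := by
  have hX : IsIrreducible (Set.range (pushout.inl f g)) := by
    rw [← Set.image_univ]
    exact (IrreducibleSpace.isIrreducible_univ X).image _ (pushout.inl f g).continuous.continuousOn
  have hY : IsIrreducible (Set.range (pushout.inr f g)) := by
    rw [← Set.image_univ]
    exact (IrreducibleSpace.isIrreducible_univ Y).image _ (pushout.inr f g).continuous.continuousOn
  obtain ⟨u⟩ := ‹Nonempty U›
  have hu : pushout.inl f g (f u) = pushout.inr f g (g u) := by
    rw [← Scheme.Hom.comp_apply, pushout.condition, Scheme.Hom.comp_apply]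
  have : Nonempty ↥(pushout f g) := ⟨pushout.inl f g (f u)⟩
  have hpre : PreirreducibleSpace ↥(pushout f g) := by
    refine ⟨?_⟩
    rintro V W hV hW ⟨v, -, hv⟩ ⟨w, -, hw⟩
    -- A nonempty open set that meets the second chart also meets the overlap, by irreducibility of
    -- that chart. So irreducibility can be tested on the first chart.
    have key : ∀ (T : Set ↥(pushout f g)), IsOpen T → T.Nonempty →
        (T ∩ Set.range (pushout.inl f g)).Nonempty := by
      rintro T hT ⟨t, ht⟩
      obtain ⟨x, rfl⟩ | ⟨y, rfl⟩ := pushout_jointly_surjective f g t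
      · exact ⟨_, ht, x, rfl⟩
      · obtain ⟨z, -, hz, hz'⟩ := hY.2 T _ hT (pushout.inl f g).isOpenEmbedding.isOpen_range
          ⟨_, ⟨y, rfl⟩, ht⟩ ⟨_, ⟨g u, rfl⟩, ⟨f u, hu⟩⟩
        exact ⟨z, hz, hz'⟩
    obtain ⟨v', hv', hv''⟩ := key V hV ⟨v, hv⟩
    obtain ⟨w', hw', hw''⟩ := key W hW ⟨w, hw⟩
    obtain ⟨z, -, hz⟩ := hX.2 V W hV hW ⟨v', hv'', hv'⟩ ⟨w', hw'', hw'⟩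
    exact ⟨z, trivial, hz⟩
  exact ⟨‹_›⟩

lemma isIntegral_pushout [IsIntegral X] [IsIntegral Y] [Nonempty U] :
    IsIntegral (pushout f g) :=
  have := isReduced_pushout f g
  have := irreducibleSpace_pushout f g
  isIntegral_of_irreducibleSpace_of_isReduced _

end pushout

end AlgebraicGeometry

/-! ### Local rings of the glued curve -/

namespace HoweCurve

/-- The local conditions in the definition of a curve, at all points. -/
lemma isRegularLocalRing_stalk_of_isDedekindDomain {R : Type u} [CommRing R] [IsDedekindDomain R]
    {X : Scheme.{u}} (i : Spec (.of R) ⟶ X) [IsOpenImmersion i] (p : Spec (.of R)) :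
    IsRegularLocalRing (X.presheaf.stalk (i p)) := by
  let q : PrimeSpectrum R := p
  let e₁ := (asIso (i.stalkMap p)).commRingCatIsoToRingEquiv
  let e₂ : (Spec (.of R)).presheaf.stalk p ≃+* Localization.AtPrime q.asIdeal :=
    (Spec.stalkIso (.of R) p).commRingCatIsoToRingEquiv
  have : IsRegularLocalRing (Localization.AtPrime q.asIdeal) :=
    IsRegularRing.isRegularLocalRing_localization q.asIdeal
  exact IsRegularLocalRing.of_ringEquiv (e₁.trans e₂).symm

/-- Closedness excludes the generic point: the point is a maximal ideal of R, nonzero since R is not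
a field, and localising there gives a discrete valuation ring. -/
lemma ringKrullDim_stalk_of_isDedekindDomain {R : Type u} [CommRing R] [IsDedekindDomain R]
    (hR : ¬ IsField R) {X : Scheme.{u}} (i : Spec (.of R) ⟶ X) [IsOpenImmersion i]
    (p : Spec (.of R)) (hp : IsClosed {i p}) :
    ringKrullDim (X.presheaf.stalk (i p)) = 1 := by
  let q : PrimeSpectrum R := p
  let e₁ := (asIso (i.stalkMap p)).commRingCatIsoToRingEquiv
  let e₂ : (Spec (.of R)).presheaf.stalk p ≃+* Localization.AtPrime q.asIdeal :=
    (Spec.stalkIso (.of R) p).commRingCatIsoToRingEquiv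
  rw [ringKrullDim_eq_of_ringEquiv (e₁.trans e₂)]
  have hp' : IsClosed {p} := by
    have := hp.preimage i.continuous
    rwa [← Set.image_singleton, Set.preimage_image_eq _ i.isOpenEmbedding.injective] at this
  have hmax : q.asIdeal.IsMaximal := (PrimeSpectrum.isClosed_singleton_iff_isMaximal q).mp hp'
  have hbot : q.asIdeal ≠ ⊥ := Ring.ne_bot_of_isMaximal_of_not_isField hmax hR
  have := IsLocalization.AtPrime.isDiscreteValuationRing_of_dedekind_domain
    R hbot (Localization.AtPrime q.asIdeal)
  exact IsPrincipalIdealRing.ringKrullDim_eq_one _ (IsDiscreteValuationRing.not_isField _)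

namespace HyperellipticEquation

variable {k : Type u} [Field k] {g : ℕ} (D : HyperellipticEquation k g)

instance : IsDomain (Chart D.poly) := Chart.isDomain D.squarefree D.natDegree_ne_zero

instance : IsDomain (Chart D.polyInfty) :=
  Chart.isDomain D.squarefree_polyInfty D.natDegree_polyInfty_ne_zero

lemma _root_.HoweCurve.Chart.x_ne_zero (f : k[X]) : Chart.x f ≠ 0 := by
  rw [Chart.x, Ne, map_eq_zero_iff _ (Chart.algebraMap_injective f)]
  exact X_ne_zero

instance : IsDomain (Overlap D.poly) :=
  IsLocalization.isDomain_localization (powers_le_nonZeroDivisors_of_noZeroDivisors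
    (Chart.x_ne_zero D.poly))

instance : IsIntegral D.curve := isIntegral_pushout D.overlapInl D.overlapInr

/-- The affine curve `y ^ 2 = f(x)` in the curve. -/
noncomputable def inl : Spec (.of (Chart D.poly)) ⟶ D.curve := pushout.inl D.overlapInl D.overlapInr

/-- The affine curve at infinity in the curve. -/
noncomputable def inr : Spec (.of (Chart D.polyInfty)) ⟶ D.curve :=
  pushout.inr D.overlapInl D.overlapInr

instance : IsOpenImmersion D.inl :=
  inferInstanceAs (IsOpenImmersion (pushout.inl D.overlapInl D.overlapInr))

instance : IsOpenImmersion D.inr :=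
  inferInstanceAs (IsOpenImmersion (pushout.inr D.overlapInl D.overlapInr))

lemma inl_toP1 : D.inl ≫ D.toP1 = D.projInl ≫ P1.inl k := pushout.inl_desc ..

lemma inr_toP1 : D.inr ≫ D.toP1 = D.projInr ≫ P1.inr k := pushout.inr_desc ..

lemma overlap_condition : D.overlapInl ≫ D.inl = D.overlapInr ≫ D.inr := pushout.condition

lemma jointly_surjective (p : D.curve) : (∃ x, D.inl x = p) ∨ ∃ y, D.inr y = p :=
  pushout_jointly_surjective D.overlapInl D.overlapInr p

lemma isRegularLocalRing_stalk (h2 : (2 : k) ≠ 0) (p : D.curve) :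
    IsRegularLocalRing (D.curve.presheaf.stalk p) := by
  have := Chart.isDedekindDomain h2 D.squarefree D.natDegree_ne_zero
  have := Chart.isDedekindDomain h2 D.squarefree_polyInfty D.natDegree_polyInfty_ne_zero
  obtain ⟨x, rfl⟩ | ⟨x, rfl⟩ := D.jointly_surjective p
  · exact isRegularLocalRing_stalk_of_isDedekindDomain _ x
  · exact isRegularLocalRing_stalk_of_isDedekindDomain _ x

lemma ringKrullDim_stalk (h2 : (2 : k) ≠ 0) (p : D.curve) (hp : IsClosed {p}) :
    ringKrullDim (D.curve.presheaf.stalk p) = 1 := by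
  have := Chart.isDedekindDomain h2 D.squarefree D.natDegree_ne_zero
  have := Chart.isDedekindDomain h2 D.squarefree_polyInfty D.natDegree_polyInfty_ne_zero
  obtain ⟨x, rfl⟩ | ⟨x, rfl⟩ := D.jointly_surjective p
  · exact ringKrullDim_stalk_of_isDedekindDomain
      (Chart.not_isField D.squarefree D.natDegree_ne_zero) _ x hp
  · exact ringKrullDim_stalk_of_isDedekindDomain
      (Chart.not_isField D.squarefree_polyInfty D.natDegree_polyInfty_ne_zero) _ x hp

end HyperellipticEquation

end HoweCurve

/-! ### Separatedness of a glued scheme -/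

namespace AlgebraicGeometry

/-- The base change of the diagonal of X along A ×_S B → X ×_S X is A ×_X B → A ×_S B, and W is A
×_X B. -/
lemma isClosedImmersion_pullback_snd_diagonal {A B W X S : Scheme.{u}} {a : A ⟶ X} {b : B ⟶ X}
    {p : W ⟶ A} {q : W ⟶ B} (s : X ⟶ S) (h : IsPullback p q a b)
    (hc : IsClosedImmersion
      (pullback.lift p q (by rw [h.w_assoc]) : W ⟶ pullback (a ≫ s) (b ≫ s))) :
    IsClosedImmersion (pullback.snd (pullback.diagonal s)
      (pullback.map (a ≫ s) (b ≫ s) s s a b (𝟙 S) (Category.comp_id _) (Category.comp_id _))) := by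
  have h1 := pullback_map_diagonal_isPullback a b s
  have h2 : IsClosedImmersion (pullback.mapDesc a b s) := by
    rw [← MorphismProperty.cancel_left_of_respectsIso (P := @IsClosedImmersion) h.isoPullback.hom]
    have e : h.isoPullback.hom ≫ pullback.mapDesc a b s =
        pullback.lift p q (by rw [h.w_assoc]) := by
      apply pullback.hom_ext
      · rw [Category.assoc, pullback.lift_fst, pullback.lift_fst, Category.comp_id,
          h.isoPullback_hom_fst]
      · rw [Category.assoc, pullback.lift_snd, pullback.lift_snd, Category.comp_id,
          h.isoPullback_hom_snd]
    rwa [e]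
  rw [← MorphismProperty.cancel_left_of_respectsIso (P := @IsClosedImmersion) h1.isoPullback.hom,
    h1.isoPullback_hom_snd]
  exact h2

/-- The products of charts cover the target of the diagonal. Over X × X and Y × Y the diagonal
restricts to that of a chart; over the two mixed products it is the map from U, up to a swap of the
factors. -/
lemma isSeparated_pushout {U X Y S : Scheme.{u}} (f : U ⟶ X) (g : U ⟶ Y) [IsOpenImmersion f]
    [IsOpenImmersion g] (s : pushout f g ⟶ S) (hX : IsSeparated (pushout.inl f g ≫ s))
    (hY : IsSeparated (pushout.inr f g ≫ s))
    (hU : IsClosedImmersion (pullback.lift f g (by rw [pushout.condition_assoc]) :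
      U ⟶ pullback (pushout.inl f g ≫ s) (pushout.inr f g ≫ s))) : IsSeparated s := by
  refine ⟨IsZariskiLocalAtTarget.of_openCover (Scheme.Pullback.openCoverOfLeftRight
    (pushoutOpenCover f g) (pushoutOpenCover f g) _ _) ?_⟩
  rintro ⟨⟨_ | _⟩, ⟨_ | _⟩⟩
  · exact isClosedImmersion_pullback_snd_diagonal s (IsKernelPair.id_of_mono (pushout.inl f g))
      hX.isClosedImmersion_diagonal
  · exact isClosedImmersion_pullback_snd_diagonal s (isPullback_pushout_of_isOpenImmersion f g) hU
  · refine isClosedImmersion_pullback_snd_diagonal s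
      (isPullback_pushout_of_isOpenImmersion f g).flip ?_
    have e : (pullback.lift g f (by rw [pushout.condition_assoc]) :
        U ⟶ pullback (pushout.inr f g ≫ s) (pushout.inl f g ≫ s)) =
        pullback.lift f g (by rw [pushout.condition_assoc]) ≫ (pullbackSymmetry _ _).hom := by
      apply pullback.hom_ext
      · rw [Category.assoc, pullbackSymmetry_hom_comp_fst, pullback.lift_fst, pullback.lift_snd]
      · rw [Category.assoc, pullbackSymmetry_hom_comp_snd, pullback.lift_fst, pullback.lift_snd]
    change IsClosedImmersion (pullback.lift g f (by rw [pushout.condition_assoc]) :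
        U ⟶ pullback (pushout.inr f g ≫ s) (pushout.inl f g ≫ s))
    rw [e, MorphismProperty.cancel_right_of_respectsIso (P := @IsClosedImmersion)]
    exact hU
  · exact isClosedImmersion_pullback_snd_diagonal s (IsKernelPair.id_of_mono (pushout.inr f g))
      hY.isClosedImmersion_diagonal

lemma isClosedImmersion_lift_of_surjective {R A B C : Type u} [CommRing R] [CommRing A]
    [CommRing B] [CommRing C] [Algebra R A] [Algebra R B] [Algebra R C] (f : A →ₐ[R] C)
    (g : B →ₐ[R] C)
    (h : Function.Surjective (Algebra.TensorProduct.lift f g fun _ _ ↦ Commute.all _ _))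
    {a : Spec (.of A) ⟶ Spec (.of R)} {b : Spec (.of B) ⟶ Spec (.of R)}
    (ha : a = Spec.map (CommRingCat.ofHom (algebraMap R A)))
    (hb : b = Spec.map (CommRingCat.ofHom (algebraMap R B)))
    (w : Spec.map (CommRingCat.ofHom f.toRingHom) ≫ a =
      Spec.map (CommRingCat.ofHom g.toRingHom) ≫ b) :
    IsClosedImmersion (pullback.lift _ _ w) := by
  subst ha hb
  rw [← MorphismProperty.cancel_right_of_respectsIso (P := @IsClosedImmersion) _
    (pullbackSpecIso R A B).hom]
  convert IsClosedImmersion.spec_of_surjective (CommRingCat.ofHom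
    (Algebra.TensorProduct.lift f g fun _ _ ↦ Commute.all _ _).toRingHom) h using 1
  rw [← cancel_mono (pullbackSpecIso R A B).inv]
  apply pullback.hom_ext
  · simp only [Category.assoc, Iso.hom_inv_id, Category.comp_id, pullback.lift_fst,
      pullbackSpecIso_inv_fst, ← Spec.map_comp, ← CommRingCat.ofHom_comp]
    congr 2
    ext x
    simp
  · simp only [Category.assoc, Iso.hom_inv_id, Category.comp_id, pullback.lift_snd,
      pullbackSpecIso_inv_snd, ← Spec.map_comp, ← CommRingCat.ofHom_comp]
    congr 2
    ext x
    simp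

end AlgebraicGeometry

/-! ### Properness of the glued curve -/

namespace HoweCurve

variable {k : Type u} [Field k]

lemma P1.inl_toSpec : P1.inl k ≫ P1.toSpec k = Spec.map (CommRingCat.ofHom C) := pushout.inl_desc ..

lemma P1.inr_toSpec : P1.inr k ≫ P1.toSpec k = Spec.map (CommRingCat.ofHom C) := pushout.inr_desc ..

instance (f : k[X]) : Algebra.FiniteType k (Chart f) :=
  Algebra.FiniteType.trans (S := k[X]) inferInstance inferInstance

lemma Chart.ringHom_ext {A : Type*} [CommRing A] {f : k[X]} {φ ψ : Chart f →+* A}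
    (hk : φ.comp (algebraMap k (Chart f)) = ψ.comp (algebraMap k (Chart f)))
    (hx : φ (Chart.x f) = ψ (Chart.x f)) (hy : φ (Chart.y f) = ψ (Chart.y f)) : φ = ψ :=
  AdjoinRoot.ringHom_ext (Polynomial.ringHom_ext (fun a ↦ congr($hk a)) hx) hy

/-- Only x has to be assumed in R: y² = f(x) then lies in R, so y is integral over R and lies in it.
-/
lemma Chart.exists_lift_of_isInteger {R K : Type*} [CommRing R] [IsDomain R] [IsIntegrallyClosed R]
    [Field K] [Algebra R K] [IsFractionRing R K] {f : k[X]} (ι : k →+* R) (a : Chart f →+* K)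
    (ha : a.comp (algebraMap k (Chart f)) = (algebraMap R K).comp ι)
    (hx : IsLocalization.IsInteger R (a (Chart.x f))) :
    ∃ ψ : Chart f →+* R, (algebraMap R K).comp ψ = a := by
  obtain ⟨x, hx⟩ := hx
  have hp : a.comp (algebraMap k[X] (Chart f)) = (algebraMap R K).comp (eval₂RingHom ι x) :=
    Polynomial.ringHom_ext (fun c ↦ by simpa using! congr($ha c))
      (by simpa using! hx.symm)
  have hy2 : a (Chart.y f) ^ 2 = algebraMap R K (f.eval₂ ι x) := by
    rw [← map_pow, Chart.y_sq]
    exact congr($hp f)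
  have hyi : IsIntegral R (a (Chart.y f)) := by
    refine IsIntegral.of_pow (n := 2) two_pos ?_
    rw [hy2]
    exact isIntegral_algebraMap
  obtain ⟨y, hy⟩ := IsIntegrallyClosed.algebraMap_eq_of_integral hyi
  have hinj : Function.Injective (algebraMap R K) := IsFractionRing.injective R K
  let ψ : Chart f →+* R := AdjoinRoot.lift (eval₂RingHom ι x) y (by
    apply hinj
    rw [eval₂_sub, eval₂_X_pow, eval₂_C, map_sub, map_pow, hy, hy2, map_zero]
    simp)
  have hψ (p : k[X]) : ψ (algebraMap k[X] (Chart f) p) = p.eval₂ ι x := AdjoinRoot.lift_of _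
  have hψy : ψ (Chart.y f) = y := AdjoinRoot.lift_root _
  refine ⟨ψ, AdjoinRoot.ringHom_ext ?_ ?_⟩
  · refine Eq.trans ?_ hp.symm
    exact RingHom.ext fun p ↦ congr_arg _ (hψ p)
  · exact (congr_arg _ hψy).trans hy

/-- Ring homomorphisms out of the coordinate ring of the overlap. -/
lemma Overlap.exists_extend {K : Type*} [Field K] {f : k[X]} (a : Chart f →+* K)
    (hx : a (Chart.x f) ≠ 0) :
    ∃ c : Overlap f →+* K, c.comp (algebraMap (Chart f) (Overlap f)) = a :=
  ⟨IsLocalization.Away.lift (Chart.x f) (g := a) hx.isUnit,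
    IsLocalization.Away.lift_comp (Chart.x f) hx.isUnit⟩

lemma Overlap.exists_extend_flip {K : Type*} [Field K] {f g : k[X]} {n : ℕ}
    (hf : f.natDegree ≤ 2 * n) (hg : reflect (2 * n) f = g) (b : Chart g →+* K)
    (hx : b (Chart.x g) ≠ 0) :
    ∃ c : Overlap f →+* K, c.comp (Overlap.flip hf hg) = b := by
  have hg' : g.natDegree ≤ 2 * n := hg ▸ natDegree_reflect hf
  have hf' : reflect (2 * n) g = f := by rw [← hg, reflect_reflect]
  obtain ⟨c, hc⟩ := Overlap.exists_extend b hx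
  refine ⟨c.comp (Overlap.flipLoc hg' hf'), ?_⟩
  rw [← hc]
  refine RingHom.ext fun z ↦ ?_
  have h := congr($(Overlap.flipLoc_flipLoc hg' hf' hf hg) (algebraMap _ _ z))
  rw [RingHom.comp_apply, Overlap.flipLoc_algebraMap] at h
  simp only [RingHom.comp_apply]
  rw [h]
  rfl

namespace HyperellipticEquation

variable {g : ℕ} (D : HyperellipticEquation k g)

lemma inl_toSpec :
    D.inl ≫ D.toSpec = Spec.map (CommRingCat.ofHom (algebraMap k (Chart D.poly))) := by
  rw [toSpec, ← Category.assoc, inl_toP1, Category.assoc, P1.inl_toSpec, projInl, ← Spec.map_comp]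
  rfl

lemma inr_toSpec :
    D.inr ≫ D.toSpec = Spec.map (CommRingCat.ofHom (algebraMap k (Chart D.polyInfty))) := by
  rw [toSpec, ← Category.assoc, inr_toP1, Category.assoc, P1.inr_toSpec, projInr, ← Spec.map_comp]
  rfl

lemma source_local (P : MorphismProperty Scheme.{u}) [IsZariskiLocalAtSource P] {Z : Scheme.{u}}
    (s : D.curve ⟶ Z) (hl : P (D.inl ≫ s)) (hr : P (D.inr ≫ s)) : P s :=
  pushout_source_local D.overlapInl D.overlapInr P s hl hr

instance : LocallyOfFiniteType D.toSpec := by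
  have : IsZariskiLocalAtSource @LocallyOfFiniteType.{u} :=
    HasRingHomProperty.instIsZariskiLocalAtSource (Q := RingHom.FiniteType)
  refine D.source_local @LocallyOfFiniteType.{u} D.toSpec ?_ ?_
  · rw [inl_toSpec, HasRingHomProperty.Spec_iff (P := @LocallyOfFiniteType)]
    exact RingHom.finiteType_algebraMap.mpr inferInstance
  · rw [inr_toSpec, HasRingHomProperty.Spec_iff (P := @LocallyOfFiniteType)]
    exact RingHom.finiteType_algebraMap.mpr inferInstance

instance : CompactSpace D.curve := by
  have h : Set.range D.inl ∪ Set.range D.inr = Set.univ := by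
    rw [Set.eq_univ_iff_forall]
    exact fun p ↦ D.jointly_surjective p
  rw [← isCompact_univ_iff, ← h]
  exact (isCompact_range D.inl.continuous).union (isCompact_range D.inr.continuous)

instance : QuasiCompact D.toSpec := (quasiCompact_iff_compactSpace (f := D.toSpec)).mpr inferInstance

/-- The map `flip` as a homomorphism of `k`-algebras. -/
noncomputable def flipAlgHom : Chart D.polyInfty →ₐ[k] Overlap D.poly where
  __ := Overlap.flip D.natDegree_le D.reflect_poly
  commutes' a := by
    refine (Overlap.flip_algebraMap D.natDegree_le D.reflect_poly (C a)).trans ?_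
    rw [Overlap.evalInv, coe_eval₂RingHom, eval₂_C]

lemma flipAlgHom_x : D.flipAlgHom (Chart.x D.polyInfty) = Overlap.xInv D.poly :=
  Overlap.flip_x D.natDegree_le D.reflect_poly

/-- On the overlap 1/x is the coordinate u of the other chart, so a/xⁿ is the image of a ⊗ uⁿ. This
makes the overlap closed in the product of the charts. -/
lemma lift_surjective : Function.Surjective (Algebra.TensorProduct.lift
    (IsScalarTower.toAlgHom k (Chart D.poly) (Overlap D.poly)) D.flipAlgHom
      fun _ _ ↦ Commute.all _ _) := by
  intro z
  obtain ⟨n, a, ha⟩ := IsLocalization.Away.surj (Chart.x D.poly) z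
  refine ⟨a ⊗ₜ (Chart.x D.polyInfty ^ n), ?_⟩
  rw [Algebra.TensorProduct.lift_tmul, map_pow, flipAlgHom_x]
  change algebraMap _ _ a * _ = _
  rw [← ha, mul_assoc, ← mul_pow]
  have := Overlap.x_mul_xInv D.poly
  rw [Overlap.x] at this
  rw [this, one_pow, mul_one]

instance : IsSeparated D.toSpec := by
  refine isSeparated_pushout D.overlapInl D.overlapInr D.toSpec ?_ ?_ ?_
  · change IsSeparated (D.inl ≫ D.toSpec)
    rw [inl_toSpec]
    infer_instance
  · change IsSeparated (D.inr ≫ D.toSpec)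
    rw [inr_toSpec]
    infer_instance
  · exact isClosedImmersion_lift_of_surjective
      (IsScalarTower.toAlgHom k (Chart D.poly) (Overlap D.poly)) D.flipAlgHom D.lift_surjective
      D.inl_toSpec D.inr_toSpec _

lemma hasLift_of_isInteger_inl (S : ValuativeCommSq D.toSpec) (a : Chart D.poly →+* S.K)
    (ha : Spec.map (CommRingCat.ofHom a) ≫ D.inl = S.i₁)
    (hx : IsLocalization.IsInteger S.R (a (Chart.x D.poly))) : S.commSq.HasLift := by
  have hw := S.commSq.w
  rw [← ha, Category.assoc, inl_toSpec, ← Spec.map_preimage S.i₂, ← Spec.map_comp,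
    ← Spec.map_comp] at hw
  have hι := congr_arg CommRingCat.Hom.hom (Spec.map_injective hw)
  obtain ⟨ψ, hψ⟩ := Chart.exists_lift_of_isInteger (Spec.preimage S.i₂).hom a hι hx
  refine ⟨⟨Spec.map (CommRingCat.ofHom ψ) ≫ D.inl, ?_, ?_⟩⟩
  · rw [← ha, ← hψ, CommRingCat.ofHom_comp, Spec.map_comp, Category.assoc]
  · rw [Category.assoc, inl_toSpec, ← Spec.map_preimage S.i₂, ← Spec.map_comp]
    congr 1
    ext1
    refine RingHom.ext fun c ↦ IsFractionRing.injective S.R S.K ?_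
    exact congr($hψ (algebraMap k _ c)).trans congr($hι c)

lemma hasLift_of_isInteger_inr (S : ValuativeCommSq D.toSpec) (a : Chart D.polyInfty →+* S.K)
    (ha : Spec.map (CommRingCat.ofHom a) ≫ D.inr = S.i₁)
    (hx : IsLocalization.IsInteger S.R (a (Chart.x D.polyInfty))) : S.commSq.HasLift := by
  have hw := S.commSq.w
  rw [← ha, Category.assoc, inr_toSpec, ← Spec.map_preimage S.i₂, ← Spec.map_comp,
    ← Spec.map_comp] at hw
  have hι := congr_arg CommRingCat.Hom.hom (Spec.map_injective hw)
  obtain ⟨ψ, hψ⟩ := Chart.exists_lift_of_isInteger (Spec.preimage S.i₂).hom a hι hx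
  refine ⟨⟨Spec.map (CommRingCat.ofHom ψ) ≫ D.inr, ?_, ?_⟩⟩
  · rw [← ha, ← hψ, CommRingCat.ofHom_comp, Spec.map_comp, Category.assoc]
  · rw [Category.assoc, inr_toSpec, ← Spec.map_preimage S.i₂, ← Spec.map_comp]
    congr 1
    ext1
    refine RingHom.ext fun c ↦ IsFractionRing.injective S.R S.K ?_
    exact congr($hψ (algebraMap k _ c)).trans congr($hι c)

/-- If the coordinate of a K-point is not in the valuation ring, it is nonzero and its inverse is in
the ring. The point then also lies in the other chart, and it extends there. -/
lemma existence_toSpec : ValuativeCriterion.Existence D.toSpec := by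
  intro S
  -- Spec K has a single point, so a K-point factors through any chart containing its image.
  have hrange {A : Type u} [CommRing A] (j : Spec (.of A) ⟶ D.curve) [IsOpenImmersion j]
      (p : Spec (.of A)) (hp : j p = S.i₁ (IsLocalRing.closedPoint S.K)) :
      ∃ a : A →+* S.K, Spec.map (CommRingCat.ofHom a) ≫ j = S.i₁ := by
    have hr : Set.range S.i₁ ⊆ Set.range j := by
      rintro _ ⟨x, rfl⟩
      obtain rfl := Subsingleton.elim x (IsLocalRing.closedPoint S.K)
      exact ⟨p, hp⟩
    refine ⟨(Spec.preimage (IsOpenImmersion.lift j S.i₁ hr)).hom, ?_⟩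
    rw [CommRingCat.ofHom_hom, Spec.map_preimage, IsOpenImmersion.lift_fac]
  have hmul (c : Overlap D.poly →+* S.K) : c (Overlap.x D.poly) * c (Overlap.xInv D.poly) = 1 := by
    rw [← map_mul, Overlap.x_mul_xInv, map_one]
  obtain ⟨p, hp⟩ | ⟨p, hp⟩ := D.jointly_surjective (S.i₁ (IsLocalRing.closedPoint S.K))
  · obtain ⟨a, ha⟩ := hrange D.inl p hp
    by_cases hx : IsLocalization.IsInteger S.R (a (Chart.x D.poly))
    · exact D.hasLift_of_isInteger_inl S a ha hx
    · have hx0 : a (Chart.x D.poly) ≠ 0 := fun h ↦ hx (h ▸ IsLocalization.isInteger_zero)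
      obtain ⟨c, hc⟩ := Overlap.exists_extend a hx0
      refine D.hasLift_of_isInteger_inr S (c.comp (Overlap.flip D.natDegree_le D.reflect_poly))
        ?_ ?_
      · rw [CommRingCat.ofHom_comp, Spec.map_comp, Category.assoc]
        change _ ≫ D.overlapInr ≫ D.inr = _
        rw [← D.overlap_condition, ← ha, ← hc, CommRingCat.ofHom_comp, Spec.map_comp,
          Category.assoc]
        rfl
      · rw [RingHom.comp_apply, Overlap.flip_x, ← inv_eq_of_mul_eq_one_right (hmul c)]
        refine (ValuationRing.isInteger_or_isInteger S.R _).resolve_left fun h ↦ hx ?_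
        rwa [← hc]
  · obtain ⟨b, hb⟩ := hrange D.inr p hp
    by_cases hx : IsLocalization.IsInteger S.R (b (Chart.x D.polyInfty))
    · exact D.hasLift_of_isInteger_inr S b hb hx
    · have hx0 : b (Chart.x D.polyInfty) ≠ 0 := fun h ↦ hx (h ▸ IsLocalization.isInteger_zero)
      obtain ⟨c, hc⟩ := Overlap.exists_extend_flip D.natDegree_le D.reflect_poly b hx0
      refine D.hasLift_of_isInteger_inl S (c.comp (algebraMap _ _)) ?_ ?_
      · rw [CommRingCat.ofHom_comp, Spec.map_comp, Category.assoc]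
        change _ ≫ D.overlapInl ≫ D.inl = _
        rw [D.overlap_condition, ← hb, ← hc, CommRingCat.ofHom_comp, Spec.map_comp,
          Category.assoc]
        rfl
      · change IsLocalization.IsInteger S.R (c (Overlap.x D.poly))
        have hinv : c (Overlap.x D.poly) = (b (Chart.x D.polyInfty))⁻¹ := by
          rw [← hc, RingHom.comp_apply, Overlap.flip_x, eq_comm]
          exact inv_eq_of_mul_eq_one_left (hmul c)
        rw [hinv]
        exact (ValuationRing.isInteger_or_isInteger S.R _).resolve_left hx

instance : UniversallyClosed D.toSpec := by
  rw [UniversallyClosed.eq_valuativeCriterion]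
  exact ⟨D.existence_toSpec, inferInstance⟩

instance : IsProper D.toSpec where

lemma isCurve_toSpec (h2 : (2 : k) ≠ 0) : IsCurve D.toSpec where
  isIntegral := inferInstance
  isProper := inferInstance
  regular p _ := D.isRegularLocalRing_stalk h2 p
  ringKrullDim_eq_one p hp := D.ringKrullDim_stalk h2 p hp

end HyperellipticEquation

end HoweCurve

/-! ### Density of the locus x ≠ 0, ∞ in the fibre product -/

namespace HoweCurve

variable {k : Type u} [Field k]

instance : IsOpenImmersion (P1.inl k) :=
  inferInstanceAs (IsOpenImmersion (pushout.inl (torusInl k) (torusInr k)))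

instance : IsOpenImmersion (P1.inr k) :=
  inferInstanceAs (IsOpenImmersion (pushout.inr (torusInl k) (torusInr k)))

/-- The chart is free of finite rank over k[x], hence flat and of finite presentation. -/
lemma universallyOpen_specMap_algebraMap_chart (f : k[X]) :
    UniversallyOpen (Spec.map (CommRingCat.ofHom (algebraMap k[X] (Chart f)))) := by
  have h1 : Flat (Spec.map (CommRingCat.ofHom (algebraMap k[X] (Chart f)))) := by
    rw [HasRingHomProperty.Spec_iff (P := @Flat)]
    exact RingHom.flat_algebraMap_iff.mpr inferInstance
  have h2 : LocallyOfFinitePresentation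
      (Spec.map (CommRingCat.ofHom (algebraMap k[X] (Chart f)))) := by
    rw [HasRingHomProperty.Spec_iff (P := @LocallyOfFinitePresentation)]
    have : Algebra.FinitePresentation k[X] (Chart f) :=
      Algebra.FinitePresentation.of_finiteType.mp inferInstance
    exact RingHom.finitePresentation_algebraMap.mpr this
  infer_instance

namespace HyperellipticEquation

variable {g : ℕ} (D : HyperellipticEquation k g)

instance : UniversallyOpen D.toP1 := by
  refine D.source_local @UniversallyOpen D.toP1 ?_ ?_
  · have : UniversallyOpen D.projInl := universallyOpen_specMap_algebraMap_chart _
    rw [inl_toP1]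
    infer_instance
  · have : UniversallyOpen D.projInr := universallyOpen_specMap_algebraMap_chart _
    rw [inr_toP1]
    infer_instance

/-- The inclusion in the curve of the locus where `x` is neither zero nor infinite. -/
noncomputable def overlapι : Spec (.of (Overlap D.poly)) ⟶ D.curve := D.overlapInl ≫ D.inl

instance : IsOpenImmersion D.overlapι := by
  unfold overlapι
  infer_instance

lemma overlapι_toP1 : D.overlapι ≫ D.toP1 =
    Spec.map (CommRingCat.ofHom (algebraMap k[X] (Overlap D.poly))) ≫ P1.inl k := by
  rw [overlapι, Category.assoc, inl_toP1, overlapInl, projInl, ← Spec.map_comp_assoc]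
  rfl

lemma overlapι_toSpec : D.overlapι ≫ D.toSpec =
    Spec.map (CommRingCat.ofHom (algebraMap k (Overlap D.poly))) := by
  rw [overlapι, Category.assoc, inl_toSpec, overlapInl, ← Spec.map_comp]
  rfl

lemma dense_range_overlapι : Dense (Set.range D.overlapι) :=
  D.overlapι.isOpenEmbedding.isOpen_range.dense (Set.range_nonempty _)

instance : IsDominant D.overlapι := ⟨D.dense_range_overlapι⟩

/-- A curve whose ring of functions on the locus `x ≠ 0, ∞` is the tensor product over `k[x]` of
those of two others is birational to their fibre product over the projective line. -/
lemma birationalOver_fiberProduct {g₁ g₂ : ℕ} (D₁ : HyperellipticEquation k g₁)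
    (D₂ : HyperellipticEquation k g₂) (φ₁ : Overlap D₁.poly →+* Overlap D.poly)
    (φ₂ : Overlap D₂.poly →+* Overlap D.poly)
    (h : IsPushout (CommRingCat.ofHom (algebraMap k[X] (Overlap D₁.poly)))
      (CommRingCat.ofHom (algebraMap k[X] (Overlap D₂.poly))) (CommRingCat.ofHom φ₁)
      (CommRingCat.ofHom φ₂))
    (hk : φ₁.comp (algebraMap k (Overlap D₁.poly)) = algebraMap k (Overlap D.poly)) :
    Scheme.BirationalOver D.toSpec (fiberProductToSpec D₁ D₂) := by
  have hp := isPullback_SpecMap_of_isPushout _ _ _ _ h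
  let j := pullback.map _ _ D₁.toP1 D₂.toP1 D₁.overlapι D₂.overlapι (P1.inl k)
    D₁.overlapι_toP1.symm D₂.overlapι_toP1.symm
  -- The image of `j` is the intersection of the preimages of two dense opens. The projections are
  -- open, being base changes of the double covers, so both preimages are dense.
  have hj : IsDominant j := by
    refine ⟨?_⟩
    rw [DenseRange, Scheme.Pullback.range_map]
    refine Dense.inter_of_isOpen_left
      (D₁.dense_range_overlapι.preimage (pullback.fst D₁.toP1 D₂.toP1).isOpenMap)
      (D₂.dense_range_overlapι.preimage (pullback.snd D₁.toP1 D₂.toP1).isOpenMap) ?_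
    exact D₁.overlapι.isOpenEmbedding.isOpen_range.preimage
      (pullback.fst D₁.toP1 D₂.toP1).continuous
  have h1 : Scheme.BirationalOver (D.overlapι ≫ D.toSpec) D.toSpec :=
    D.overlapι.birationalOver _ _ rfl
  refine h1.symm.trans ((hp.isoPullback.hom ≫ j).birationalOver _ _ ?_)
  have e : hp.isoPullback.hom ≫ j ≫ pullback.fst D₁.toP1 D₂.toP1 =
      Spec.map (CommRingCat.ofHom φ₁) ≫ D₁.overlapι := by
    rw [pullback.lift_fst, ← Category.assoc, hp.isoPullback_hom_fst]
  have e' : hp.isoPullback.hom ≫ j ≫ pullback.fst D₁.toP1 D₂.toP1 ≫ D₁.toSpec =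
      D.overlapι ≫ D.toSpec := by
    rw [reassoc_of% e, overlapι_toSpec, overlapι_toSpec, ← Spec.map_comp, ← CommRingCat.ofHom_comp,
      hk]
  exact (Category.assoc _ _ _).trans e'

end HyperellipticEquation

/-! ### Ring homomorphisms out of the coordinate ring of the overlap -/

namespace Overlap

variable {f : k[X]} {R : Type*} [CommRing R]

/-- The point `(x, y)` with values in `R` of the affine curve `y ^ 2 = f(x)`. -/
noncomputable def _root_.HoweCurve.Chart.lift (ι : k →+* R) (x y : R) (hy : y ^ 2 = f.eval₂ ι x) :
    Chart f →+* R :=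
  AdjoinRoot.lift (eval₂RingHom ι x) y
    (by rw [eval₂_sub, eval₂_X_pow, eval₂_C, hy, coe_eval₂RingHom, sub_self])

lemma _root_.HoweCurve.Chart.lift_x (ι : k →+* R) (x y : R) (hy : y ^ 2 = f.eval₂ ι x) :
    Chart.lift ι x y hy (Chart.x f) = x :=
  (AdjoinRoot.lift_of _).trans (eval₂_X _ _)

/-- The point `(x, y)` with values in `R` of the curve `y ^ 2 = f(x)`, where `x` is a unit. -/
noncomputable def lift (ι : k →+* R) (x y : R) (hx : IsUnit x) (hy : y ^ 2 = f.eval₂ ι x) :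
    Overlap f →+* R :=
  IsLocalization.Away.lift (Chart.x f) (g := Chart.lift ι x y hy) (by rwa [Chart.lift_x])

variable (ι : k →+* R) (x y : R) (hx : IsUnit x) (hy : y ^ 2 = f.eval₂ ι x)

lemma lift_x : lift ι x y hx hy (Overlap.x f) = x :=
  (IsLocalization.Away.lift_eq _ (by rwa [Chart.lift_x]) _).trans (Chart.lift_x ..)

lemma lift_y : lift ι x y hx hy (Overlap.y f) = y :=
  (IsLocalization.Away.lift_eq _ (by rwa [Chart.lift_x]) _).trans (AdjoinRoot.lift_root _)

lemma lift_algebraMap (a : k) : lift ι x y hx hy (algebraMap k (Overlap f) a) = ι a :=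
  (IsLocalization.Away.lift_eq _ (by rwa [Chart.lift_x]) _).trans
    ((AdjoinRoot.lift_of _).trans (eval₂_C _ _))

lemma exists_ringHom (ι : k →+* R) (x y : R) (hx : IsUnit x) (hy : y ^ 2 = f.eval₂ ι x) :
    ∃ φ : Overlap f →+* R, (∀ a, φ (algebraMap k (Overlap f) a) = ι a) ∧ φ (Overlap.x f) = x ∧ φ (Overlap.y f) = y :=
  ⟨lift ι x y hx hy, lift_algebraMap ι x y hx hy, lift_x ι x y hx hy, lift_y ι x y hx hy⟩

lemma ringHom_ext {φ ψ : Overlap f →+* R}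
    (hk : ∀ a, φ (algebraMap k (Overlap f) a) = ψ (algebraMap k (Overlap f) a))
    (hx : φ (Overlap.x f) = ψ (Overlap.x f)) (hy : φ (Overlap.y f) = ψ (Overlap.y f)) : φ = ψ :=
  IsLocalization.ringHom_ext (Submonoid.powers (Chart.x f))
    (Chart.ringHom_ext (RingHom.ext hk) hx hy)

end Overlap

end HoweCurve

/-- This reduces the computation of a tensor product to solving equations in an arbitrary ring R:
one solution has to exist and be unique. -/
lemma CommRingCat.isPushout_of_exists_of_ext {A B C P : Type u} [CommRing A] [CommRing B]
    [CommRing C] [CommRing P] {f : A →+* B} {g : A →+* C} {i : B →+* P} {j : C →+* P}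
    (w : i.comp f = j.comp g)
    (hex : ∀ (R : Type u) [CommRing R] (a : B →+* R) (b : C →+* R), a.comp f = b.comp g →
      ∃ c : P →+* R, c.comp i = a ∧ c.comp j = b)
    (hext : ∀ (R : Type u) [CommRing R] (c c' : P →+* R), c.comp i = c'.comp i →
      c.comp j = c'.comp j → c = c') :
    IsPushout (CommRingCat.ofHom f) (CommRingCat.ofHom g) (CommRingCat.ofHom i)
      (CommRingCat.ofHom j) := by
  have hw : CommRingCat.ofHom f ≫ CommRingCat.ofHom i =
      CommRingCat.ofHom g ≫ CommRingCat.ofHom j := by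
    rw [← CommRingCat.ofHom_comp, ← CommRingCat.ofHom_comp, w]
  have hs (s : PushoutCocone (CommRingCat.ofHom f) (CommRingCat.ofHom g)) :
      ∃ c : P →+* s.pt, c.comp i = s.inl.hom ∧ c.comp j = s.inr.hom :=
    hex s.pt s.inl.hom s.inr.hom (congr_arg CommRingCat.Hom.hom s.condition)
  choose c hc hc' using hs
  refine ⟨⟨hw⟩, ⟨PushoutCocone.IsColimit.mk hw (fun s ↦ CommRingCat.ofHom (c s)) ?_ ?_ ?_⟩⟩
  · exact fun s ↦ CommRingCat.hom_ext (hc s)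
  · exact fun s ↦ CommRingCat.hom_ext (hc' s)
  · intro s m h1 h2
    refine CommRingCat.hom_ext (hext _ _ _ ?_ ?_)
    · exact (congr_arg CommRingCat.Hom.hom h1).trans (hc s).symm
    · exact (congr_arg CommRingCat.Hom.hom h2).trans (hc' s).symm

/-! ### The change of coordinates between the octic and the fibre product -/

namespace HoweCurve

section identities

variable {R : Type*} [CommRing R]

/-- A point `(X, Y)` of the octic curve gives a point of the fibre product. -/
lemma exists_point_fiberProduct {A B c r p h X V Y : R} (hB : B = A - c) (hr : r ^ 2 = -c)
    (h2 : 2 * h = 1) (hV : X * V = 1)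
    (hY : c ^ 2 * Y ^ 2 = c ^ 2 * (X ^ 2 + 1) ^ 4 - 8 * A * c * (X ^ 2 + 1) ^ 2 * X ^ 2 +
      16 * (A ^ 2 - 4 * p) * X ^ 4) :
    ∃ x x' y₁ y₂ : R, x * x' = p ∧ y₁ ^ 2 = x * (x ^ 2 - A * x + p) ∧
      y₂ ^ 2 = x * (x ^ 2 - B * x + p) ∧ y₁ = -(x * (r * h) * (X + V)) ∧
      y₂ = -(x * (r * h) * (V - X)) ∧
      8 * x = 4 * A - c * (X + V) ^ 2 + c * Y * V ^ 2 := by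
  have h3 : 8 * h ^ 3 = 1 := by linear_combination (4 * h ^ 2 + 2 * h + 1) * h2
  -- The octic equation divided by X⁴, with V = 1/X: it says that (cYV²)² is 16 times the
  -- discriminant s² − 4p, where s = A − c(X + V)²/4.
  have hZ : (c * Y * V ^ 2) ^ 2 =
      c ^ 2 * (X + V) ^ 4 - 8 * A * c * (X + V) ^ 2 + 16 * (A ^ 2 - 4 * p) := by
    have e1 : (X ^ 2 + 1) * V = X + V := by linear_combination X * hV
    have e2 : (X * V) ^ 2 = 1 := by rw [hV, one_pow]
    calc (c * Y * V ^ 2) ^ 2 = (c ^ 2 * Y ^ 2) * V ^ 4 := by ring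
      _ = c ^ 2 * ((X ^ 2 + 1) * V) ^ 4 - 8 * A * c * ((X ^ 2 + 1) * V) ^ 2 * (X * V) ^ 2 +
          16 * (A ^ 2 - 4 * p) * ((X * V) ^ 2) ^ 2 := by rw [hY]; ring
      _ = _ := by rw [e1, e2]; ring
  -- x and x' are the roots of T² − sT + p by the quadratic formula; h³ stands for 1/8.
  obtain ⟨x, hx⟩ : ∃ x, x = h ^ 3 * (4 * A - c * (X + V) ^ 2 + c * Y * V ^ 2) := ⟨_, rfl⟩
  obtain ⟨x', hx'⟩ : ∃ x, x = h ^ 3 * (4 * A - c * (X + V) ^ 2 - c * Y * V ^ 2) := ⟨_, rfl⟩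
  have hxx : x * x' = p := by
    rw [hx, hx']
    linear_combination -h ^ 6 * hZ + p * (8 * h ^ 3 + 1) * h3
  have hs : (r * h * (X + V)) ^ 2 = x + x' - A := by
    rw [hx, hx']
    linear_combination h ^ 2 * (X + V) ^ 2 * hr - A * h3 + c * (X + V) ^ 2 * h ^ 2 * h2
  have hs' : (r * h * (V - X)) ^ 2 = x + x' - B := by
    rw [hB]
    linear_combination hs - 4 * r ^ 2 * h ^ 2 * hV - 4 * h ^ 2 * hr + c * (2 * h + 1) * h2
  refine ⟨x, x', _, _, hxx, ?_, ?_, rfl, rfl, ?_⟩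
  · linear_combination x ^ 2 * hs + x * hxx
  · linear_combination x ^ 2 * hs' + x * hxx
  · rw [hx]
    linear_combination (4 * A - c * (X + V) ^ 2 + c * Y * V ^ 2) * h3

/-- A point of the fibre product gives a point `(X, Y)` of the octic curve. -/
lemma exists_point_octic {A B c r q p h x u y₁ y₂ : R} (hB : B = A - c) (hr : r ^ 2 = -c)
    (hq : r * q = 1) (h2 : 2 * h = 1) (hu : x * u = 1) (hy₁ : y₁ ^ 2 = x * (x ^ 2 - A * x + p))
    (hy₂ : y₂ ^ 2 = x * (x ^ 2 - B * x + p)) :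
    ∃ X V Y : R, X * V = 1 ∧
      c ^ 2 * Y ^ 2 = c ^ 2 * (X ^ 2 + 1) ^ 4 - 8 * A * c * (X ^ 2 + 1) ^ 2 * X ^ 2 +
        16 * (A ^ 2 - 4 * p) * X ^ 4 ∧
      y₁ = -(x * (r * h) * (X + V)) ∧ y₂ = -(x * (r * h) * (V - X)) ∧
      8 * x = 4 * A - c * (X + V) ^ 2 + c * Y * V ^ 2 := by
  -- The two factors of y₂² − y₁² = cx², divided by rx and, for V, negated, so that their product is
  -- 1. Here u = 1/x and q = 1/r.
  obtain ⟨X, hX⟩ : ∃ X, X = (y₂ - y₁) * u * q := ⟨_, rfl⟩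
  obtain ⟨V, hV⟩ : ∃ V, V = -((y₂ + y₁) * u * q) := ⟨_, rfl⟩
  have hcq : c * q ^ 2 = -1 := by linear_combination q ^ 2 * hr - (r * q + 1) * hq
  have hxu : (x * u) ^ 2 = 1 := by rw [hu, one_pow]
  have hXV : X * V = 1 := by
    have : X * V = (c * q ^ 2) * -(x * u) ^ 2 := by
      rw [hX, hV]
      linear_combination -(u * q) ^ 2 * (hy₂ - hy₁) + x ^ 2 * u ^ 2 * q ^ 2 * hB
    rw [this, hcq, hxu]
    ring
  have hs : 4 * (y₁ * u) ^ 2 = -c * (X + V) ^ 2 := by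
    rw [hX, hV]
    linear_combination 4 * (y₁ * u) ^ 2 * hcq
  have hs' : (y₁ * u) ^ 2 = x - A + p * u := by
    linear_combination u ^ 2 * hy₁ + (x * (x * u + 1) - A * (x * u + 1) + p * u) * hu
  have hsX : 4 * (y₁ * u) ^ 2 * X ^ 2 = -c * (X ^ 2 + 1) ^ 2 := by
    rw [hs]
    linear_combination -c * (2 * X ^ 2 + X * V + 1) * hXV
  -- Y is 4X²(x − p/x)/c, since −q² = 1/c: the difference of the two roots, rescaled.
  refine ⟨X, V, -4 * X ^ 2 * q ^ 2 * (x - p * u), hXV, ?_, ?_, ?_, ?_⟩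
  · have e1 : c ^ 2 * (-4 * X ^ 2 * q ^ 2 * (x - p * u)) ^ 2 =
        (c * q ^ 2) ^ 2 * (16 * X ^ 4 * (x - p * u) ^ 2) := by ring
    have e2 : (x - p * u) ^ 2 = ((y₁ * u) ^ 2 + A) ^ 2 - 4 * p := by
      rw [hs']
      linear_combination -4 * p * hu
    rw [e1, hcq, e2]
    linear_combination (4 * (y₁ * u) ^ 2 * X ^ 2 - c * (X ^ 2 + 1) ^ 2 + 8 * A * X ^ 2) * hsX
  · rw [hX, hV]
    linear_combination -y₁ * (h2 + 2 * h * hu + 2 * h * x * u * hq)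
  · rw [hX, hV]
    linear_combination -y₂ * (h2 + 2 * h * hu + 2 * h * x * u * hq)
  · have e : c * (-4 * X ^ 2 * q ^ 2 * (x - p * u)) * V ^ 2 =
        (c * q ^ 2) * (X * V) ^ 2 * (-4 * (x - p * u)) := by ring
    rw [e, hcq, hXV]
    linear_combination hs - 4 * hs'

/-- A point of the octic curve is determined by that of the fibre product. -/
lemma point_octic_unique {A c r q h x u y₁ y₂ X V Y X' V' Y' : R} (hr : r ^ 2 = -c)
    (hq : r * q = 1) (h2 : 2 * h = 1) (hu : x * u = 1) (hV : X * V = 1) (hV' : X' * V' = 1)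
    (h₁ : y₁ = -(x * (r * h) * (X + V))) (h₂ : y₂ = -(x * (r * h) * (V - X)))
    (hx : 8 * x = 4 * A - c * (X + V) ^ 2 + c * Y * V ^ 2)
    (h₁' : y₁ = -(x * (r * h) * (X' + V'))) (h₂' : y₂ = -(x * (r * h) * (V' - X')))
    (hx' : 8 * x = 4 * A - c * (X' + V') ^ 2 + c * Y' * V' ^ 2) : X = X' ∧ Y = Y' := by
  have e {X V : R} (h₁ : y₁ = -(x * (r * h) * (X + V))) (h₂ : y₂ = -(x * (r * h) * (V - X))) :
      X = (y₂ - y₁) * u * q := by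
    rw [h₁, h₂]
    linear_combination -X * (h2 + 2 * h * hu + 2 * h * x * u * hq)
  have hXX : X = X' := (e h₁ h₂).trans (e h₁' h₂').symm
  subst hXX
  have hVV : V = V' := by linear_combination V' * hV - V * hV'
  subst hVV
  refine ⟨rfl, ?_⟩
  have hcq : c * q ^ 2 = -1 := by linear_combination q ^ 2 * hr - (r * q + 1) * hq
  have hd : c * q ^ 2 * (X * V) ^ 2 * (Y - Y') = 0 := by
    linear_combination q ^ 2 * X ^ 2 * (hx' - hx)
  rw [hcq, hV] at hd
  linear_combination -hd

end identities

section birational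

variable {k : Type u} [Field k]

lemma eval₂_ellipticEquation {R : Type*} [CommRing R] {a b : k} (ha : a ≠ 0) (hb : b ≠ 0)
    (hab : a ≠ b) (ι : k →+* R) (x : R) :
    (ellipticEquation a b ha hb hab).poly.eval₂ ι x =
      x * (x ^ 2 - ι (a + b) * x + ι (a * b)) := by
  simp only [ellipticEquation, eval₂_mul, eval₂_sub, eval₂_X, eval₂_C, map_add, map_mul]
  ring

/-- The relation between the coordinates of the octic curve and those of the fibre product. -/
lemma birationalOver_fiberProduct_of_octic {α₂ α₃ β₂ β₃ : k} (hα₂ : α₂ ≠ 0) (hα₃ : α₃ ≠ 0)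
    (hβ₂ : β₂ ≠ 0) (hβ₃ : β₃ ≠ 0) (hα : α₂ ≠ α₃) (hβ : β₂ ≠ β₃) (hαβ : α₂ * α₃ = β₂ * β₃)
    (h2 : (2 : k) ≠ 0) {c r : k} (hc : c = α₂ + α₃ - β₂ - β₃) (hc0 : c ≠ 0) (hr : r ^ 2 = -c)
    {g : ℕ} (D : HyperellipticEquation k g)
    (hD : C c ^ 2 * D.poly = C c ^ 2 * (X ^ 2 + 1) ^ 4 -
      8 * C (α₂ + α₃) * C c * (X ^ 2 + 1) ^ 2 * X ^ 2 +
        16 * (C (α₂ + α₃) ^ 2 - 4 * C (α₂ * α₃)) * X ^ 4) :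
    Scheme.BirationalOver D.toSpec (fiberProductToSpec (ellipticEquation α₂ α₃ hα₂ hα₃ hα)
      (ellipticEquation β₂ β₃ hβ₂ hβ₃ hβ)) := by
  have hr0 : r ≠ 0 := by
    rintro rfl
    apply hc0
    linear_combination hr
  have hev {R : Type u} [CommRing R] (ι : k →+* R) (x : R) :
      ι c ^ 2 * D.poly.eval₂ ι x = ι c ^ 2 * (x ^ 2 + 1) ^ 4 -
        8 * ι (α₂ + α₃) * ι c * (x ^ 2 + 1) ^ 2 * x ^ 2 +
          16 * (ι (α₂ + α₃) ^ 2 - 4 * ι (α₂ * α₃)) * x ^ 4 := by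
    have := congr_arg (eval₂ ι x) hD
    simpa [eval₂_mul, eval₂_add, eval₂_sub, eval₂_pow] using this
  have hB {R : Type u} [CommRing R] (ι : k →+* R) : ι (β₂ + β₃) = ι (α₂ + α₃) - ι c := by
    rw [← map_sub, hc]
    ring_nf
  have hr' {R : Type u} [CommRing R] (ι : k →+* R) : ι r ^ 2 = -ι c := by
    rw [← map_pow, hr, map_neg]
  have hq {R : Type u} [CommRing R] (ι : k →+* R) : ι r * ι r⁻¹ = 1 := by
    rw [← map_mul, mul_inv_cancel₀ hr0, map_one]
  have hh {R : Type u} [CommRing R] (ι : k →+* R) : 2 * ι 2⁻¹ = 1 := by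
    rw [← map_ofNat ι 2, ← map_mul, mul_inv_cancel₀ h2, map_one]
  have hp {R : Type u} [CommRing R] (ι : k →+* R) : ι (α₂ * α₃) * ι (α₂ * α₃)⁻¹ = 1 := by
    rw [← map_mul, mul_inv_cancel₀ (mul_ne_zero hα₂ hα₃), map_one]
  let κ : k →+* Overlap D.poly := algebraMap k _
  obtain ⟨x, x', y₁, y₂, hxx, hy₁, hy₂, hyX₁, hyX₂, hxX⟩ := exists_point_fiberProduct
    (h := κ 2⁻¹) (hB κ) (hr' κ) (hh κ) (Overlap.x_mul_xInv D.poly)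
    ((congr_arg _ (Overlap.y_sq D.poly)).trans (hev κ (Overlap.x D.poly)))
  -- The other root supplies the inverse: x x' = α₂α₃ is a nonzero constant. Hence X ≠ 0 on the
  -- octic lands in x ≠ 0.
  have hx : IsUnit x := IsUnit.of_mul_eq_one (x' * κ (α₂ * α₃)⁻¹) (by
    rw [← mul_assoc, hxx, hp])
  obtain ⟨φ₁, hφ₁k, hφ₁x, hφ₁y⟩ := Overlap.exists_ringHom
    (f := (ellipticEquation α₂ α₃ hα₂ hα₃ hα).poly) κ x y₁ hx (by rw [eval₂_ellipticEquation, hy₁])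
  obtain ⟨φ₂, hφ₂k, hφ₂x, hφ₂y⟩ := Overlap.exists_ringHom
    (f := (ellipticEquation β₂ β₃ hβ₂ hβ₃ hβ).poly) κ x y₂ hx (by rw [eval₂_ellipticEquation, hy₂, hαβ])
  refine D.birationalOver_fiberProduct _ _ φ₁ φ₂ ?_ (RingHom.ext hφ₁k)
  refine CommRingCat.isPushout_of_exists_of_ext ?_ ?_ ?_
  · refine Polynomial.ringHom_ext (fun a ↦ ?_) ?_
    · exact (hφ₁k a).trans (hφ₂k a).symm
    · exact hφ₁x.trans hφ₂x.symm
  -- Existence: a pair of R-points of E₁ and E₂ with the same x comes from an R-point of the octic.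
  · intro R _ a b hab
    let ι : k →+* R := a.comp (algebraMap k _)
    have hab' (c : k) : b (algebraMap k _ c) = ι c := congr($hab (C c)).symm
    have habx : b (Overlap.x _) = a (Overlap.x _) := congr($hab X).symm
    have ha1 : a (Overlap.y _) ^ 2 = a (Overlap.x _) * (a (Overlap.x _) ^ 2 -
        ι (α₂ + α₃) * a (Overlap.x _) + ι (α₂ * α₃)) := by
      rw [← eval₂_ellipticEquation hα₂ hα₃ hα, ← map_pow, Overlap.y_sq, hom_eval₂]
    have hb1 : b (Overlap.y _) ^ 2 = a (Overlap.x _) * (a (Overlap.x _) ^ 2 -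
        ι (β₂ + β₃) * a (Overlap.x _) + ι (α₂ * α₃)) := by
      rw [hαβ, ← eval₂_ellipticEquation hβ₂ hβ₃ hβ, ← map_pow, Overlap.y_sq, hom_eval₂, habx,
        show b.comp (algebraMap k _) = ι from RingHom.ext hab']
    have hau : a (Overlap.x _) * a (Overlap.xInv _) = 1 := by
      rw [← map_mul, Overlap.x_mul_xInv, map_one]
    obtain ⟨X₀, V₀, Y₀, hXV, hXY, h1, h2, h3⟩ :=
      exists_point_octic (h := ι 2⁻¹) (hB ι) (hr' ι) (hq ι) (hh ι) hau ha1 hb1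
    have hcu : IsUnit (ι c ^ 2) := ((IsUnit.mk0 c hc0).map ι).pow 2
    obtain ⟨ψ, hψk, hψX, hψY⟩ := Overlap.exists_ringHom (f := D.poly) ι X₀ Y₀
      (IsUnit.of_mul_eq_one V₀ hXV) (hcu.mul_left_cancel (hXY.trans (hev ι X₀).symm))
    change ∀ c, ψ (κ c) = ι c at hψk
    -- Both are inverses of X₀.
    have hψV : ψ (Overlap.xInv _) = V₀ := by
      have : X₀ * ψ (Overlap.xInv _) = 1 := by
        rw [← hψX, ← map_mul, Overlap.x_mul_xInv, map_one]
      linear_combination V₀ * this - ψ (Overlap.xInv _) * hXV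
    have hψx : ψ x = a (Overlap.x _) := by
      have h8 : IsUnit (8 : R) := by
        have : (8 : R) * ι 2⁻¹ ^ 3 = 1 := by
          linear_combination (4 * ι 2⁻¹ ^ 2 + 2 * ι 2⁻¹ + 1) * hh ι
        exact IsUnit.of_mul_eq_one _ this
      have := congr_arg ψ hxX
      simp only [map_mul, map_add, map_sub, map_pow, hψX, hψY, hψV, hψk, map_ofNat] at this
      exact h8.mul_left_cancel (this.trans (by rw [h3, map_add]))
    refine ⟨ψ, Overlap.ringHom_ext (fun c ↦ ?_) ?_ ?_, Overlap.ringHom_ext (fun c ↦ ?_) ?_ ?_⟩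
    · exact (congr_arg ψ (hφ₁k c)).trans (hψk c)
    · exact (congr_arg ψ hφ₁x).trans hψx
    · refine (congr_arg ψ hφ₁y).trans ?_
      rw [hyX₁, h1]
      simp only [map_mul, map_add, map_neg, hψX, hψV, hψk, hψx]
    · exact (congr_arg ψ (hφ₂k c)).trans ((hψk c).trans (hab' c).symm)
    · exact (congr_arg ψ hφ₂x).trans (hψx.trans habx.symm)
    · refine (congr_arg ψ hφ₂y).trans ?_
      rw [hyX₂, h2]
      simp only [map_mul, map_sub, map_neg, hψX, hψV, hψk, hψx]
  -- Uniqueness: X is recovered from y₁, y₂ and x, and Y from the formula for 8x.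
  · intro R _ ψ ψ' he1 he2
    have hk (c : k) : ψ (κ c) = ψ' (κ c) := by
      have := congr($he1 (algebraMap k _ c))
      rwa [RingHom.comp_apply, RingHom.comp_apply, hφ₁k] at this
    have hx' : ψ x = ψ' x := by
      have := congr($he1 (Overlap.x _))
      rwa [RingHom.comp_apply, RingHom.comp_apply, hφ₁x] at this
    have hy₁' : ψ y₁ = ψ' y₁ := by
      have := congr($he1 (Overlap.y _))
      rwa [RingHom.comp_apply, RingHom.comp_apply, hφ₁y] at this
    have hy₂' : ψ y₂ = ψ' y₂ := by
      have := congr($he2 (Overlap.y _))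
      rwa [RingHom.comp_apply, RingHom.comp_apply, hφ₂y] at this
    let ι : k →+* R := ψ.comp κ
    obtain ⟨u, hu⟩ := (hx.map ψ).exists_right_inv
    have key (χ : Overlap D.poly →+* R) (hk : ∀ c, χ (κ c) = ι c) (hx : χ x = ψ x)
        (h₁ : χ y₁ = ψ y₁) (h₂ : χ y₂ = ψ y₂) :
        χ (Overlap.x _) * χ (Overlap.xInv _) = 1 ∧
        ψ y₁ = -(ψ x * (ι r * ι 2⁻¹) * (χ (Overlap.x _) + χ (Overlap.xInv _))) ∧
        ψ y₂ = -(ψ x * (ι r * ι 2⁻¹) * (χ (Overlap.xInv _) - χ (Overlap.x _))) ∧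
        8 * ψ x = 4 * ι (α₂ + α₃) - ι c * (χ (Overlap.x _) + χ (Overlap.xInv _)) ^ 2 +
          ι c * χ (Overlap.y _) * χ (Overlap.xInv _) ^ 2 := by
      refine ⟨by rw [← map_mul, Overlap.x_mul_xInv, map_one], ?_, ?_, ?_⟩
      · rw [← h₁, ← hx, ← hk, ← hk, hyX₁]
        simp only [map_mul, map_add, map_neg]
      · rw [← h₂, ← hx, ← hk, ← hk, hyX₂]
        simp only [map_mul, map_sub, map_neg]
      · have := congr_arg χ hxX
        simpa only [map_mul, map_add, map_sub, map_pow, map_ofNat, hk, hx] using this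
    obtain ⟨i1, i2, i3, i4⟩ := key ψ (fun _ ↦ rfl) rfl rfl rfl
    obtain ⟨j1, j2, j3, j4⟩ := key ψ' (fun c ↦ (hk c).symm) hx'.symm hy₁'.symm hy₂'.symm
    obtain ⟨hX, hY⟩ := point_octic_unique (hr' ι) (hq ι) (hh ι) hu i1 j1 i2 i3 i4 j2 j3 j4
    exact Overlap.ringHom_ext hk hX hY

end birational

end HoweCurve

/-! ### Birational curves are isomorphic -/

lemma IsRegularLocalRing.valuationRing (R : Type*) [CommRing R] [IsDomain R]
    [IsRegularLocalRing R] (h : ringKrullDim R = 1) : ValuationRing R := by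
  have h1 : (IsLocalRing.maximalIdeal R).spanFinrank = 1 := by
    have := IsRegularLocalRing.spanFinrank_maximalIdeal (R := R)
    rw [h] at this
    exact_mod_cast this
  exact ((tfae_of_isNoetherianRing_of_isLocalRing_of_isDomain R).out 4 1).mp
    ((Submodule.spanFinrank_eq_one_iff _).mp h1).1

namespace AlgebraicGeometry.Scheme

lemma isSeparated_of_isAffine {Y S : Scheme.{u}} (s : Y ⟶ S) [IsAffine S]
    [AlgebraicGeometry.IsSeparated s] :
    Y.IsSeparated := by
  rw [Scheme.isSeparated_iff, ← terminal.comp_from s]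
  infer_instance

variable {X Y S : Scheme.{u}} {sX : X ⟶ S} {sY : Y ⟶ S}

lemma PartialMap.fromFunctionField_eq [IrreducibleSpace X] (f : X.PartialMap Y) {x : X}
    (hx : x ∈ f.domain) :
    f.fromFunctionField = Spec.map (X.presheaf.stalkSpecializes
      ((genericPoint_spec X).specializes trivial)) ≫ f.fromSpecStalkOfMem hx := by
  rw [fromFunctionField, fromSpecStalkOfMem, fromSpecStalkOfMem, ← Category.assoc]
  congr 1
  rw [← cancel_mono f.domain.ι, Category.assoc, Opens.fromSpecStalkOfMem_ι,
    Opens.fromSpecStalkOfMem_ι, SpecMap_stalkSpecializes_fromSpecStalk]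

/-- The valuative criterion extends the map at the generic point to the spectrum of the local ring
at x. As Y is of finite type over S, this extension spreads out to a neighbourhood of x, where it
represents the same rational map. -/
lemma PartialMap.mem_domain_toRationalMap_of_valuationRing [IsIntegral X] [IsProper sY]
    (f : X.PartialMap Y) (hf : f.hom ≫ sY = f.domain.ι ≫ sX) (x : X)
    [ValuationRing (X.presheaf.stalk x)] : x ∈ f.toRationalMap.domain := by
  have hex : ValuativeCriterion.Existence sY := by
    have h : UniversallyClosed sY := inferInstance
    rw [UniversallyClosed.eq_valuativeCriterion] at h
    exact h.1
  have hsq : f.fromFunctionField ≫ sY =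
      Spec.map (CommRingCat.ofHom (algebraMap (X.presheaf.stalk x) X.functionField)) ≫
        X.fromSpecStalk x ≫ sX := by
    have e : Spec.map (CommRingCat.ofHom (algebraMap (X.presheaf.stalk x) X.functionField)) ≫
        X.fromSpecStalk x = X.fromSpecStalk (genericPoint X) :=
      SpecMap_stalkSpecializes_fromSpecStalk ((genericPoint_spec X).specializes trivial)
    rw [reassoc_of% e, fromFunctionField, fromSpecStalkOfMem, Category.assoc, hf,
      Opens.fromSpecStalkOfMem_ι_assoc]
  let : ValuativeCommSq sY :=
    @ValuativeCommSq.mk _ _ sY (X.presheaf.stalk x) _ inferInstance ‹_› X.functionField _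
      (stalkFunctionFieldAlgebra X x) inferInstance f.fromFunctionField (X.fromSpecStalk x ≫ sX)
      ⟨hsq⟩
  obtain ⟨l, hl₁, hl₂⟩ : ∃ l : Spec (X.presheaf.stalk x) ⟶ Y,
      Spec.map (CommRingCat.ofHom (algebraMap (X.presheaf.stalk x) X.functionField)) ≫ l =
        f.fromFunctionField ∧ l ≫ sY = X.fromSpecStalk x ≫ sX :=
    have h := (hex this).exists_lift.some
    ⟨h.l, h.fac_left, h.fac_right⟩
  let g : X.PartialMap Y := ofFromSpecStalk sX sY l hl₂
  have hg : x ∈ g.domain := mem_domain_ofFromSpecStalk sX sY l hl₂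
  refine RationalMap.mem_domain.mpr ⟨g, hg, RationalMap.eq_of_fromFunctionField_eq _ _ ?_⟩
  rw [RationalMap.fromFunctionField_toRationalMap, RationalMap.fromFunctionField_toRationalMap,
    g.fromFunctionField_eq hg, fromSpecStalkOfMem_ofFromSpecStalk]
  exact hl₁

lemma PartialMap.exists_hom_of_valuationRing [IsIntegral X] [CompactSpace X] [IsAffine S]
    [IsProper sY] (hX : ∀ x : X, IsClosed {x} → ValuationRing (X.presheaf.stalk x))
    (f : X.PartialMap Y) (hf : f.hom ≫ sY = f.domain.ι ≫ sX) :
    ∃ F : X ⟶ Y, F ≫ sY = sX ∧ f.domain.ι ≫ F = f.hom := by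
  have : Y.IsSeparated := isSeparated_of_isAffine sY
  have htop : f.toRationalMap.domain = ⊤ := by
    by_contra hne
    -- Closed points suffice: a nonempty closed subset of a quasi-compact scheme contains one.
    obtain ⟨x, hx, hc⟩ := (f.toRationalMap.domain.isOpen.isClosed_compl).exists_closed_singleton
      (Set.nonempty_compl.mpr fun h ↦ hne (TopologicalSpace.Opens.ext h))
    have := hX x hc
    exact hx (f.mem_domain_toRationalMap_of_valuationRing hf x)
  have hr := f.toPartialMap_toRationalMap_restrict
  change X.homOfLE _ ≫ _ = _ at hr
  have hle : ⊤ ≤ f.toRationalMap.toPartialMap.domain := htop.ge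
  have hF : f.domain.ι ≫ X.topIso.inv ≫ X.homOfLE hle ≫ f.toRationalMap.toPartialMap.hom =
      f.hom := by
    rw [← hr, ← Category.assoc, ← Category.assoc]
    congr 1
    rw [← cancel_mono f.toRationalMap.toPartialMap.domain.ι]
    simp only [Category.assoc]
    trans f.domain.ι
    · simp
    · exact (X.homOfLE_ι _).symm
  refine ⟨X.topIso.inv ≫ X.homOfLE hle ≫ f.toRationalMap.toPartialMap.hom, ?_, hF⟩
  have := Opens.isDominant_ι f.dense_domain
  have : S.IsSeparated := inferInstance
  exact ext_of_isDominant f.domain.ι (by rw [← Category.assoc, hF, hf])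

end AlgebraicGeometry.Scheme

namespace HoweCurve

variable {k : Type u} [Field k] {X Y : Scheme.{u}} {s : X ⟶ Spec (.of k)} {t : Y ⟶ Spec (.of k)}

lemma IsCurve.valuationRing (hs : IsCurve s) (x : X) (hx : IsClosed ({x} : Set X)) :
    haveI := hs.isIntegral
    ValuationRing (X.presheaf.stalk x) :=
  haveI := hs.isIntegral
  haveI := hs.regular x hx
  IsRegularLocalRing.valuationRing _ (hs.ringKrullDim_eq_one x hx)

lemma IsCurve.exists_hom (hs : IsCurve s) (ht : IsCurve t) (f : X.PartialIso Y)
    (hf : f.IsOver s t) : ∃ F : X ⟶ Y, F ≫ t = s ∧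
      f.source.ι ≫ F = f.iso.hom ≫ f.target.ι := by
  have := hs.isIntegral
  have := hs.isProper
  have := ht.isProper
  have : CompactSpace X := QuasiCompact.compactSpace_of_compactSpace s
  exact f.toPartialMap.exists_hom_of_valuationRing hs.valuationRing
    ((Category.assoc _ _ _).trans hf)

/-- Curves that are birational over `k` are isomorphic over `k`. -/
theorem IsCurve.exists_iso_of_birationalOver (hs : IsCurve s) (ht : IsCurve t)
    (h : Scheme.BirationalOver s t) : ∃ e : X ≅ Y, e.hom ≫ t = s := by
  obtain ⟨f, hf⟩ := h
  obtain ⟨F, hF, hF'⟩ := hs.exists_hom ht f hf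
  obtain ⟨G, hG, hG'⟩ := ht.exists_hom hs f.symm hf.symm
  have := hs.isIntegral
  have := ht.isIntegral
  have := hs.isProper
  have := ht.isProper
  have : X.IsSeparated := Scheme.isSeparated_of_isAffine s
  have : Y.IsSeparated := Scheme.isSeparated_of_isAffine t
  have := Opens.isDominant_ι f.dense_source
  have := Opens.isDominant_ι f.dense_target
  change f.target.ι ≫ G = f.iso.inv ≫ f.source.ι at hG'
  -- The two composites are the identity on dense opens, hence everywhere by reducedness and
  -- separatedness.
  refine ⟨⟨F, G, ext_of_isDominant f.source.ι ?_, ext_of_isDominant f.target.ι ?_⟩, hF⟩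
  · rw [reassoc_of% hF', hG', Iso.hom_inv_id_assoc, Category.comp_id]
  · rw [reassoc_of% hG', hF', Iso.inv_hom_id_assoc, Category.comp_id]

end HoweCurve

/-! ### The octic polynomial and its factors -/

namespace HoweCurve

section Octic

variable {k : Type u} [Field k]

lemma isCoprime_X_sq_sub_C {a b : k} (h : a ≠ b) :
    IsCoprime (X ^ 2 - C a : k[X]) (X ^ 2 - C b) := by
  have hC : C ((b - a)⁻¹) * C (b - a) = (1 : k[X]) := by
    rw [← C_mul, inv_mul_cancel₀ (sub_ne_zero.mpr h.symm), C_1]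
  refine ⟨C ((b - a)⁻¹), -C ((b - a)⁻¹), ?_⟩
  rw [C_sub] at hC
  linear_combination hC

lemma squarefree_four_X_sq_sub_C (h2 : (2 : k) ≠ 0) {e₁ e₂ e₃ e₄ : k} (h₁ : e₁ ≠ 0) (h₂ : e₂ ≠ 0)
    (h₃ : e₃ ≠ 0) (h₄ : e₄ ≠ 0) (h₁₂ : e₁ ≠ e₂) (h₁₃ : e₁ ≠ e₃) (h₁₄ : e₁ ≠ e₄) (h₂₃ : e₂ ≠ e₃)
    (h₂₄ : e₂ ≠ e₄) (h₃₄ : e₃ ≠ e₄) :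
    Squarefree ((X ^ 2 - C e₁) * (X ^ 2 - C e₂) * (X ^ 2 - C e₃) * (X ^ 2 - C e₄) : k[X]) := by
  have hs {e : k} (he : e ≠ 0) : (X ^ 2 - C e : k[X]).Separable :=
    separable_X_pow_sub_C e (by exact_mod_cast h2) he
  exact (((hs h₁).mul (hs h₂) (isCoprime_X_sq_sub_C h₁₂)).mul (hs h₃)
    (.mul_left (isCoprime_X_sq_sub_C h₁₃) (isCoprime_X_sq_sub_C h₂₃))).mul (hs h₄)
    (.mul_left (.mul_left (isCoprime_X_sq_sub_C h₁₄) (isCoprime_X_sq_sub_C h₂₄))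
      (isCoprime_X_sq_sub_C h₃₄)) |>.squarefree

lemma natDegree_four_X_sq_sub_C (e₁ e₂ e₃ e₄ : k) :
    ((X ^ 2 - C e₁) * (X ^ 2 - C e₂) * (X ^ 2 - C e₃) * (X ^ 2 - C e₄) : k[X]).natDegree = 8 := by
  have hm (e : k) : (X ^ 2 - C e : k[X]).Monic := monic_X_pow_sub_C e two_ne_zero
  rw [((hm e₁).mul (hm e₂) |>.mul (hm e₃)).natDegree_mul (hm e₄),
    ((hm e₁).mul (hm e₂)).natDegree_mul (hm e₃), (hm e₁).natDegree_mul (hm e₂)]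
  simp

/-- As (M + N)(M − N) = c, the values (M ± N)²/c have product 1 and sum (4M² − 2c)/c. Used with M =
a₂ ± a₃ and N = b₂ ± b₃. -/
lemma C_mul_X_sq_sub_C_mul_X_sq_sub_C {c M N : k} (hc0 : c ≠ 0) (hc : M ^ 2 - N ^ 2 = c) :
    C c * ((X ^ 2 - C ((M + N) ^ 2 / c)) * (X ^ 2 - C ((M - N) ^ 2 / c))) =
      C c * (X ^ 2 + 1) ^ 2 - 4 * C M ^ 2 * X ^ 2 := by
  have h₁ : C c * C ((M + N) ^ 2 / c) = (C M + C N) ^ 2 := by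
    rw [← C_mul, mul_div_cancel₀ _ hc0, C_pow, C_add]
  have h₂ : C c * C ((M - N) ^ 2 / c) = (C M - C N) ^ 2 := by
    rw [← C_mul, mul_div_cancel₀ _ hc0, C_pow, C_sub]
  have h₃ : C ((M + N) ^ 2 / c) * C ((M - N) ^ 2 / c) = 1 := by
    rw [← C_mul, div_mul_div_comm, ← mul_pow, show (M + N) * (M - N) = c by rw [← hc]; ring,
      ← sq, div_self (pow_ne_zero 2 hc0), C_1]
  have h₄ : C M ^ 2 - C N ^ 2 = C c := by rw [← hc]; simp
  linear_combination (-X ^ 2) * h₁ - X ^ 2 * h₂ + C c * h₃ + 2 * X ^ 2 * h₄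

end Octic

/-- If the sums agreed as the products do, α₂ would be a root of (T − β₂)(T − β₃). -/
lemma add_sub_sub_ne_zero {k : Type u} [Field k] {α₂ α₃ β₂ β₃ : k} (h₂₂ : α₂ ≠ β₂)
    (h₂₃ : α₂ ≠ β₃) (hαβ : α₂ * α₃ = β₂ * β₃) : α₂ + α₃ - β₂ - β₃ ≠ 0 := fun h ↦
  mul_ne_zero (sub_ne_zero.mpr h₂₂) (sub_ne_zero.mpr h₂₃)
    (by linear_combination α₂ * h - hαβ)

end HoweCurve

theorem mainTheorem1 {k : Type u} [Field k] [IsAlgClosed k] (h2 : (2 : k) ≠ 0)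
    (α₂ α₃ β₂ β₃ : k) (hα₂ : α₂ ≠ 0) (hα₃ : α₃ ≠ 0) (hβ₂ : β₂ ≠ 0) (hβ₃ : β₃ ≠ 0)
    (hα : α₂ ≠ α₃) (h₂₂ : α₂ ≠ β₂) (h₂₃ : α₂ ≠ β₃) (h₃₂ : α₃ ≠ β₂) (h₃₃ : α₃ ≠ β₃) (hβ : β₂ ≠ β₃)
    (hαβ : α₂ * α₃ = β₂ * β₃) :
    -- square roots with compatible signs exist
    (∃ a₂ a₃ b₂ b₃ : k, a₂ ^ 2 = α₂ ∧ a₃ ^ 2 = α₃ ∧ b₂ ^ 2 = β₂ ∧ b₃ ^ 2 = β₃ ∧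
      a₂ * a₃ = b₂ * b₃) ∧
    α₂ + α₃ - β₂ - β₃ ≠ 0 ∧
    -- and for every such choice the octic equation represents the curve
    ∀ a₂ a₃ b₂ b₃ : k, a₂ ^ 2 = α₂ → a₃ ^ 2 = α₃ → b₂ ^ 2 = β₂ → b₃ ^ 2 = β₃ →
      a₂ * a₃ = b₂ * b₃ →
      ∃ D : HoweCurve.HyperellipticEquation k 3,
        D.poly =
          (X ^ 2 - C ((a₂ + a₃ + b₂ + b₃) ^ 2 / (α₂ + α₃ - β₂ - β₃))) *
          (X ^ 2 - C ((a₂ + a₃ - b₂ - b₃) ^ 2 / (α₂ + α₃ - β₂ - β₃))) *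
          (X ^ 2 - C ((a₂ - a₃ + b₂ - b₃) ^ 2 / (α₂ + α₃ - β₂ - β₃))) *
          (X ^ 2 - C ((a₂ - a₃ - b₂ + b₃) ^ 2 / (α₂ + α₃ - β₂ - β₃))) ∧
        HoweCurve.IsCurve D.toSpec ∧
        Scheme.BirationalOver D.toSpec (HoweCurve.fiberProductToSpec
          (HoweCurve.ellipticEquation α₂ α₃ hα₂ hα₃ hα)
          (HoweCurve.ellipticEquation β₂ β₃ hβ₂ hβ₃ hβ)) ∧
        ∀ (S : Scheme.{u}) (s : S ⟶ Spec (.of k)), HoweCurve.IsCurve s →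
          Scheme.BirationalOver s (HoweCurve.fiberProductToSpec
            (HoweCurve.ellipticEquation α₂ α₃ hα₂ hα₃ hα)
            (HoweCurve.ellipticEquation β₂ β₃ hβ₂ hβ₃ hβ)) →
          ∃ e : S ≅ D.curve, e.hom ≫ D.toSpec = s := by
  have hc0 := HoweCurve.add_sub_sub_ne_zero h₂₂ h₂₃ hαβ
  refine ⟨?_, hc0, ?_⟩
  · obtain ⟨a₂, ha₂⟩ := IsAlgClosed.exists_pow_nat_eq α₂ two_pos
    obtain ⟨a₃, ha₃⟩ := IsAlgClosed.exists_pow_nat_eq α₃ two_pos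
    obtain ⟨b₂, hb₂⟩ := IsAlgClosed.exists_pow_nat_eq β₂ two_pos
    have hb : b₂ ≠ 0 := by
      rintro rfl
      exact hβ₂ (by rw [← hb₂]; ring)
    -- The compatibility of signs defines the fourth root; its square is α₂α₃/β₂ = β₃.
    refine ⟨a₂, a₃, b₂, a₂ * a₃ / b₂, ha₂, ha₃, hb₂, ?_, (mul_div_cancel₀ _ hb).symm⟩
    rw [div_pow, mul_pow, ha₂, ha₃, hb₂, hαβ, mul_div_cancel_left₀ _ hβ₂]
  intro a₂ a₃ b₂ b₃ ha₂ ha₃ hb₂ hb₃ hab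
  set c := α₂ + α₃ - β₂ - β₃ with hc
  -- r is the constant in the parametrisation of the conic y₂² − y₁² = cx².
  obtain ⟨r, hr⟩ := IsAlgClosed.exists_pow_nat_eq (-c) two_pos
  have hMN : (a₂ + a₃) ^ 2 - (b₂ + b₃) ^ 2 = c := by
    rw [hc]; linear_combination ha₂ + ha₃ - hb₂ - hb₃ + 2 * hab
  have hmn : (a₂ - a₃) ^ 2 - (b₂ - b₃) ^ 2 = c := by
    rw [hc]; linear_combination ha₂ + ha₃ - hb₂ - hb₃ - 2 * hab
  have h4 : (4 : k) ≠ 0 := by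
    have : (4 : k) = 2 * 2 := by norm_num
    rw [this]
    exact mul_ne_zero h2 h2
  have hadd {a b : k} (h : a ^ 2 ≠ b ^ 2) : a + b ≠ 0 := fun h' ↦
    h (by linear_combination (a - b) * h')
  have hsub {a b : k} (h : a ^ 2 ≠ b ^ 2) : a - b ≠ 0 := fun h' ↦
    h (by linear_combination (a + b) * h')
  -- For two of the four numerators s², t², the factors s − t and s + t are twice sums or
  -- differences of two chosen roots. These are nonzero since the α's and β's are distinct.
  have hne {s t p q : k} (hst : s ^ 2 - t ^ 2 = 4 * (p * q)) (hp : p ≠ 0) (hq : q ≠ 0) :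
      s ^ 2 / c ≠ t ^ 2 / c := fun h ↦ by
    rw [div_left_inj' hc0, ← sub_eq_zero, hst] at h
    exact mul_ne_zero h4 (mul_ne_zero hp hq) h
  -- The four linear forms pair off into products equal to c, so none vanishes.
  have hne0 {s t : k} (hst : s * t = c) : s ^ 2 / c ≠ 0 :=
    div_ne_zero (pow_ne_zero 2 (left_ne_zero_of_mul (hst ▸ hc0))) hc0
  subst ha₂ ha₃ hb₂ hb₃
  let D : HoweCurve.HyperellipticEquation k 3 :=
    { poly := (X ^ 2 - C ((a₂ + a₃ + b₂ + b₃) ^ 2 / c)) * (X ^ 2 - C ((a₂ + a₃ - b₂ - b₃) ^ 2 / c)) *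
        (X ^ 2 - C ((a₂ - a₃ + b₂ - b₃) ^ 2 / c)) * (X ^ 2 - C ((a₂ - a₃ - b₂ + b₃) ^ 2 / c))
      squarefree := HoweCurve.squarefree_four_X_sq_sub_C h2
        (hne0 (t := a₂ + a₃ - b₂ - b₃) (by linear_combination hMN))
        (hne0 (t := a₂ + a₃ + b₂ + b₃) (by linear_combination hMN))
        (hne0 (t := a₂ - a₃ - b₂ + b₃) (by linear_combination hmn))
        (hne0 (t := a₂ - a₃ + b₂ - b₃) (by linear_combination hmn))
        (hne (by ring) (hadd hα) (hadd hβ))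
        (hne (by ring) (hadd h₂₂) (hadd h₃₃))
        (hne (by ring) (hadd h₂₃) (hadd h₃₂))
        (hne (by ring) (hsub h₂₃) (hsub h₃₂))
        (hne (by ring) (hsub h₂₂) (hsub h₃₃))
        (hne (by ring) (hsub hα) (hsub hβ))
      natDegree_eq := .inr (HoweCurve.natDegree_four_X_sq_sub_C _ _ _ _) }
  -- The product of c(X² + 1)² − 4(a₂ + a₃)²X² and c(X² + 1)² − 4(a₂ − a₃)²X², expanded in A and p.
  have hD : C c ^ 2 * D.poly = C c ^ 2 * (X ^ 2 + 1) ^ 4 -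
      8 * C (a₂ ^ 2 + a₃ ^ 2) * C c * (X ^ 2 + 1) ^ 2 * X ^ 2 +
        16 * (C (a₂ ^ 2 + a₃ ^ 2) ^ 2 - 4 * C (a₂ ^ 2 * a₃ ^ 2)) * X ^ 4 := by
    have h₁ := HoweCurve.C_mul_X_sq_sub_C_mul_X_sq_sub_C hc0 hMN
    have h₂ := HoweCurve.C_mul_X_sq_sub_C_mul_X_sq_sub_C hc0 hmn
    rw [show a₂ + a₃ + (b₂ + b₃) = a₂ + a₃ + b₂ + b₃ by ring,
      show a₂ + a₃ - (b₂ + b₃) = a₂ + a₃ - b₂ - b₃ by ring] at h₁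
    rw [show a₂ - a₃ + (b₂ - b₃) = a₂ - a₃ + b₂ - b₃ by ring,
      show a₂ - a₃ - (b₂ - b₃) = a₂ - a₃ - b₂ + b₃ by ring] at h₂
    have h₃ := congr($h₁ * $h₂)
    simp only [C_add, C_sub, C_mul, C_pow] at h₃ ⊢
    linear_combination h₃
  have hbir := HoweCurve.birationalOver_fiberProduct_of_octic hα₂ hα₃ hβ₂ hβ₃ hα hβ hαβ h2 hc hc0 hr D hD
  exact ⟨D, rfl, D.isCurve_toSpec h2, hbir, fun S s hs h ↦
    hs.exists_iso_of_birationalOver (D.isCurve_toSpec h2) (h.trans hbir.symm)⟩
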